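/- Throughout, $\|\cdot\|$ is the maximum norm on $\mathbb R^n$, $\mathbb R^m$ and their products, $\|\cdot\|_\infty$ is the (essential) supremum norm (equal to $0$ on an empty interval), and $\mathcal K,\mathcal K_\infty,\mathcal{KL}$ are the usual classes of (jointly) continuous comparison functions on $[0,\infty)$, resp. $[0,\infty)^2$. Let $r\ge 0$, $0\le\Delta_{\min}\le\Delta_{\max}$, $d_{\min}\in[0,1)$, $B_U,B_X^0>0$, $M_1\ge 0$, and let $f:\mathbb R^n\times\mathbb R^n\times\mathbb R^m\to\mathbb R^n$ be Lipschitz on bounded sets with $f(0,0,0)=0$. Write $C=C^0([-\Delta_{\max},0];\mathbb R^n)$ with the norm $\|\cdot\|_\infty$, $U=\{u\in\mathbb R^m:\|u\|\le B_U\}$; let $\mathcal U$ be the set of measurable $u:[-r,\infty)\to U$ and $\mathcal D$ the set of $C^1$ functions $\Delta:[0,\infty)\to[\Delta_{\min},\Delta_{\max}]$ with $|\dot\Delta|\le d_{\min}$. The system $\Sigma$ is $$\dot x(t)=f\big(x(t),x(t-\Delta(t)),u(t-r)\big)\ \text{ for a.e. } t\ge 0,\qquad x(t)=\xi(t)\ \text{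 for } t\in[-\Delta_{\max},0],$$ with $\xi\in C$, $u\in\mathcal U$, $\Delta\in\mathcal D$; solutions are continuous on $[-\Delta_{\max},\infty)$ and locally absolutely continuous on $[0,\infty)$, and $x_t(\xi,u,\Delta)\in C$ is the segment $x_t(\theta)=x(t+\theta)$. A $\xi$ is an admissible initial condition if $\xi\in C^1([-\Delta_{\max},0];\mathbb R^n)$, $\|\xi\|_\infty\le B_X^0$ and $\|\dot\xi\|_\infty\le M_1$. Assume that $\Sigma$ is input-to-state stable: there are $\beta_{ISS}\in\mathcal{KL}$, $\gamma_{ISS}\in\mathcal K$ such that for all $\xi\in C$, $u\in\mathcal U$, $\Delta\in\mathcal D$ the solution exists for all $t\ge0$ and $\|x_t(\xi,u,\Delta)\|_\infty\le\max\{\beta_{ISS}(\|\xi\|_\infty,t),\gamma_{ISS}(\|u|_{[-r,t-r)}\|_\infty)\}$. Fix such gains and put $B_X=\max\{\beta_{ISS}(B_X^0,0),\gamma_{ISS}(B_U)\}$, $X=\{x\in\mathbb R^n:\|x\|\le B_X\}$, $\mathcal X=C^0([-\Delta_{\max},0];X)$, $L=\max\{M_1,\sup_{x,y\in X,u\in U}\|f(x,y,u)\|\}$.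 For $x\in C$, $v\in\mathbb R^n$, $\theta>0$ let $x^{\theta}[v]\in C$ be $x(s+\theta)$ for $s\in[-\Delta_{\max},-\theta)$ and $x(0)+(s+\theta)v$ for $s\in[-\Delta_{\max},0]$ with $s\ge-\theta$. A $\delta$-IDSS Lyapunov–Krasovskii functional for $\Sigma$ is a functional $V=V^{\Delta}:[0,\infty)\times C\times C\to[0,\infty)$, possibly depending on the delay signal $\Delta\in\mathcal D$, locally Lipschitz for each $\Delta$, for which there are, independently of $\Delta$, functions $\alpha_1,\alpha_2,\underline\gamma_a,\overline\gamma_a\in\mathcal K_\infty$, $\alpha_3,\rho\in\mathcal K$ and a continuous $M_a:C\to[0,\infty)$ with $\underline\gamma_a(\|x(0)\|)\le M_a(x)\le\overline\gamma_a(\|x\|_\infty)$ for all $x\in C$, such that for every $\Delta\in\mathcal D$: (i) $\alpha_1(\|x_1(0)-x_2(0)\|)\le V^\Delta(t,x_1,x_2)\le\alpha_2(M_a(x_1-x_2))$ for all $t\ge 0$, $x_1,x_2\in C$; (ii) for all $x_1,x_2\in\mathcal X$, $u_1,u_2\in U$, $d\in\mathbb R^n$ with $\|d\|\le L(\Delta_{\max}-\Delta_{\min})$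 and $M_a(x_1-x_2)\ge\rho(\|(u_1-u_2,d)\|)$, one has for almost every $t\ge 0$ $$\limsup_{\theta\to0^+}\frac{V^\Delta\big(t+\theta,\,x_1^{\theta}[v_1],\,x_2^{\theta}[v_2]\big)-V^\Delta(t,x_1,x_2)}{\theta}\le-\alpha_3(M_a(x_1-x_2)),$$ where $v_1=f(x_1(0),x_1(-\Delta(t))+d,u_1)$ and $v_2=f(x_2(0),x_2(-\Delta(t)),u_2)$. Theorem. If $\Sigma$ admits a $\delta$-IDSS Lyapunov–Krasovskii functional, then $\Sigma$ is incrementally input–delay–to–state stable ($\delta$-IDSS): there are $\beta\in\mathcal{KL}$ and $\gamma_U,\gamma_D\in\mathcal K$ such that for all admissible initial conditions $\xi_1,\xi_2$, all $u_1,u_2\in\mathcal U$ and all $\Delta_1,\Delta_2\in\mathcal D$ the corresponding solutions exist for all $t\ge 0$ and, for every $t\ge 0$, $$\|x_t(\xi_1,u_1,\Delta_1)-x_t(\xi_2,u_2,\Delta_2)\|_\infty\le\max\big\{\beta(\|\xi_1-\xi_2\|_\infty,t),\ \gamma_U(\|(u_1-u_2)|_{[-r,t-r)}\|_\infty)+\gamma_D(\|(\Delta_1-\Delta_2)|_{[0,t)}\|_\infty)\big\}.$$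 -/

import Mathlib

open Set Filter Topology MeasureTheory

noncomputable section

/-! ## Comparison functions

Functions on the nonnegative reals are represented by functions on `ℝ` whose values at negative
arguments are irrelevant. The space `Fin n → ℝ` carries the maximum norm, and products carry the
maximum of the norms of the components. -/

/-- Class `K`: continuous and strictly increasing on `[0, ∞)`, vanishing at `0`. -/
structure ClassK (g : ℝ → ℝ) : Prop where
  continuousOn : ContinuousOn g (Ici 0)
  strictMonoOn : StrictMonoOn g (Ici 0)
  map_zero : g 0 = 0

/-- Class `K∞`: class `K` and unbounded. -/
structure ClassKInf (g : ℝ → ℝ) : Prop extends ClassK g where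
  tendsto_atTop : Tendsto g atTop atTop

/-- Class `KL`: continuous on `[0, ∞) × [0, ∞)`, of class `K` in the first argument, (weakly)
decreasing to `0` in the second. -/
structure ClassKL (b : ℝ → ℝ → ℝ) : Prop where
  continuousOn : ContinuousOn (fun p : ℝ × ℝ => b p.1 p.2) (Ici 0 ×ˢ Ici 0)
  classK : ∀ s, 0 ≤ s → ClassK fun ρ => b ρ s
  antitoneOn : ∀ ρ, 0 ≤ ρ → AntitoneOn (b ρ) (Ici 0)
  tendsto_zero : ∀ ρ, 0 ≤ ρ → Tendsto (b ρ) atTop (𝓝 0)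

/-- Essential supremum norm of the restriction of `g` to the set `I` (zero if `I` is empty). -/
def essNorm {E : Type*} [NormedAddCommGroup E] (g : ℝ → E) (I : Set ℝ) : ℝ :=
  (eLpNormEssSup g (volume.restrict I)).toReal

/-! ## Histories -/

/-- The space of continuous functions `[-h, 0] → ℝⁿ`, with the supremum norm. -/
abbrev History (h : ℝ) (n : ℕ) : Type := C(Icc (-h) (0 : ℝ), Fin n → ℝ)

namespace History

variable {h : ℝ} {n : ℕ}

/-- Value of a history at `s ∈ [-h, 0]` (the history is extended by constants elsewhere). -/
def eval (hh : 0 ≤ h) (φ : History h n) (s : ℝ) : Fin n → ℝ :=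
  IccExtend (neg_nonpos.2 hh) φ s

theorem eval_of_mem (hh : 0 ≤ h) (φ : History h n) {s : ℝ} (hs : s ∈ Icc (-h) 0) :
    φ.eval hh s = φ ⟨s, hs⟩ :=
  IccExtend_of_mem _ _ hs

theorem continuous_eval (hh : 0 ≤ h) (φ : History h n) : Continuous (φ.eval hh) :=
  φ.continuous.Icc_extend'

/-- The history after time `θ ≥ 0` when `φ` is prolonged beyond `0` by the straight line of slope
`v`: it is `φ (s + θ)` for `s ∈ [-h, -θ)` and `φ 0 + (s + θ) v` for `s ∈ [-θ, 0]`. -/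
def advance (hh : 0 ≤ h) (φ : History h n) (v : Fin n → ℝ) (θ : ℝ) : History h n where
  toFun s := φ.eval hh (min (s + θ) 0) + max ((s : ℝ) + θ) 0 • v
  continuous_toFun := by
    have := φ.continuous_eval hh
    fun_prop

theorem advance_of_lt (hh : 0 ≤ h) (φ : History h n) (v : Fin n → ℝ) {θ : ℝ}
    (s : Icc (-h) (0 : ℝ)) (hs : (s : ℝ) < -θ) :
    φ.advance hh v θ s = φ.eval hh (s + θ) := by
  have h1 : (s : ℝ) + θ ≤ 0 := by linarith
  simp [advance, h1]

theorem advance_of_le (hh : 0 ≤ h) (φ : History h n) (v : Fin n → ℝ) {θ : ℝ}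
    (s : Icc (-h) (0 : ℝ)) (hs : -θ ≤ (s : ℝ)) :
    φ.advance hh v θ s = φ.eval hh 0 + ((s : ℝ) + θ) • v := by
  have h1 : 0 ≤ (s : ℝ) + θ := by linarith
  simp [advance, h1]

/-- The segment `x_t ∈ C([-h, 0]; ℝⁿ)`, `x_t(θ) = x(t + θ)`, of a function that is continuous on
`[-h, ∞)`, at a time `t ≥ 0`. -/
def segment (x : ℝ → Fin n → ℝ) (hx : ContinuousOn x (Ici (-h))) (t : ℝ) (ht : 0 ≤ t) :
    History h n where
  toFun θ := x (t + θ)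
  continuous_toFun := by
    refine hx.comp_continuous (by fun_prop) fun θ => ?_
    have := θ.2.1
    simp only [mem_Ici]
    linarith

end History

/-! ## Time-varying time-delay systems -/

/-- The data of the system `x'(t) = f (x(t), x(t - Δ(t)), u(t - r))` with its standing
assumptions: `f` vanishes at the origin and is Lipschitz on bounded sets; `r` is the input delay;
delay signals take values in `[delayMin, delayMax]` and have derivative bounded by `dMin < 1`;
`BU` bounds the inputs; `BX0` and `M1` bound the initial conditions and their derivatives. -/
structure TimeDelaySystem (n m : ℕ) where
  f : (Fin n → ℝ) → (Fin n → ℝ) → (Fin m → ℝ) → (Fin n → ℝ)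
  r : ℝ
  delayMin : ℝ
  delayMax : ℝ
  dMin : ℝ
  BU : ℝ
  BX0 : ℝ
  M1 : ℝ
  r_nonneg : 0 ≤ r
  delayMin_nonneg : 0 ≤ delayMin
  delayMin_le : delayMin ≤ delayMax
  dMin_nonneg : 0 ≤ dMin
  dMin_lt_one : dMin < 1
  BU_pos : 0 < BU
  BX0_pos : 0 < BX0
  M1_nonneg : 0 ≤ M1
  f_zero : f 0 0 0 = 0
  f_lipschitz : ∀ K : Set ((Fin n → ℝ) × (Fin n → ℝ) × (Fin m → ℝ)), Bornology.IsBounded K →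
    ∃ κ : ℝ, 0 < κ ∧ ∀ x₁ y₁ u₁ x₂ y₂ u₂, (x₁, y₁, u₁) ∈ K → (x₂, y₂, u₂) ∈ K →
      ‖f x₁ y₁ u₁ - f x₂ y₂ u₂‖ ≤ κ * (‖x₁ - x₂‖ + ‖y₁ - y₂‖ + ‖u₁ - u₂‖)

namespace TimeDelaySystem

variable {n m : ℕ} (S : TimeDelaySystem n m)

theorem delayMax_nonneg : 0 ≤ S.delayMax := S.delayMin_nonneg.trans S.delayMin_le

/-- The space `C([-delayMax, 0]; ℝⁿ)`. -/
abbrev Hist : Type := History S.delayMax n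

/-- Value at `s ∈ [-delayMax, 0]` of a history. -/
abbrev ev (φ : S.Hist) (s : ℝ) : Fin n → ℝ := φ.eval S.delayMax_nonneg s

/-- The class of input signals: (Lebesgue) measurable functions from `[-r, ∞)` to the closed ball
of radius `BU` (values at times before `-r` are irrelevant). -/
structure IsInput (u : ℝ → Fin m → ℝ) : Prop where
  measurable : AEMeasurable u (volume.restrict (Ici (-S.r)))
  bound : ∀ t, -S.r ≤ t → ‖u t‖ ≤ S.BU

/-- The class of delay signals: continuously differentiable functions from `[0, ∞)` to
`[delayMin, delayMax]` with derivative bounded by `dMin` (values at negative times are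
irrelevant). -/
structure IsDelay (D : ℝ → ℝ) : Prop where
  mem : ∀ t, 0 ≤ t → D t ∈ Icc S.delayMin S.delayMax
  contDiffOn : ContDiffOn ℝ 1 D (Ici 0)
  deriv_bound : ∀ t, 0 ≤ t → |derivWithin D (Ici 0) t| ≤ S.dMin

/-- The admissible initial conditions: continuously differentiable on `[-delayMax, 0]`, bounded by
`BX0`, with derivative bounded by `M1`. -/
structure IsInitial (ξ : S.Hist) : Prop where
  contDiffOn : ContDiffOn ℝ 1 (S.ev ξ) (Icc (-S.delayMax) 0)
  bound : ‖ξ‖ ≤ S.BX0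
  deriv_bound : ∀ s ∈ Icc (-S.delayMax) 0,
    ‖derivWithin (S.ev ξ) (Icc (-S.delayMax) 0) s‖ ≤ S.M1

/-- `x` is the (Carathéodory) solution on `[-delayMax, ∞)` with initial history `ξ`, input `u` and
delay signal `D`: it is continuous, agrees with `ξ` on `[-delayMax, 0]`, is locally absolutely
continuous on `[0, ∞)`, and satisfies the equation at almost every `t ≥ 0`. -/
structure IsSolution (ξ : S.Hist) (u : ℝ → Fin m → ℝ) (D : ℝ → ℝ) (x : ℝ → Fin n → ℝ) :
    Prop where
  continuousOn : ContinuousOn x (Ici (-S.delayMax))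
  initial : ∀ s : Icc (-S.delayMax) (0 : ℝ), x s = ξ s
  absolutelyContinuous : ∀ T, 0 ≤ T → AbsolutelyContinuousOnInterval x 0 T
  equation : ∀ᵐ t ∂(volume.restrict (Ici (0 : ℝ))),
    HasDerivAt x (S.f (x t) (x (t - D t)) (u (t - S.r))) t

/-- Input-to-state stability with given gains `β` and `γ`: for all continuous initial histories,
all inputs and all delay signals, the solution exists for all times and obeys the estimate. -/
structure ISSWith (β : ℝ → ℝ → ℝ) (γ : ℝ → ℝ) : Prop where
  classKL : ClassKL β
  classK : ClassK γ
  existence : ∀ (ξ : S.Hist) (u : ℝ → Fin m → ℝ) (D : ℝ → ℝ), S.IsInput u → S.IsDelay D →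
    ∃ x, S.IsSolution ξ u D x
  estimate : ∀ (ξ : S.Hist) (u : ℝ → Fin m → ℝ) (D : ℝ → ℝ), S.IsInput u → S.IsDelay D →
    ∀ (x : ℝ → Fin n → ℝ) (hx : S.IsSolution ξ u D x) (t : ℝ) (ht : 0 ≤ t),
      ‖History.segment x hx.continuousOn t ht‖ ≤
        max (β ‖ξ‖ t) (γ (essNorm u (Ico (-S.r) (t - S.r))))

/-- Incremental input-delay-to-state stability. -/
def IsDeltaIDSS : Prop :=
  ∃ (β : ℝ → ℝ → ℝ) (γU γD : ℝ → ℝ), ClassKL β ∧ ClassK γU ∧ ClassK γD ∧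
    ∀ (ξ₁ ξ₂ : S.Hist) (u₁ u₂ : ℝ → Fin m → ℝ) (D₁ D₂ : ℝ → ℝ),
      S.IsInitial ξ₁ → S.IsInitial ξ₂ → S.IsInput u₁ → S.IsInput u₂ →
      S.IsDelay D₁ → S.IsDelay D₂ →
      (∃ x₁, S.IsSolution ξ₁ u₁ D₁ x₁) ∧ (∃ x₂, S.IsSolution ξ₂ u₂ D₂ x₂) ∧
      ∀ (x₁ x₂ : ℝ → Fin n → ℝ) (h₁ : S.IsSolution ξ₁ u₁ D₁ x₁)
        (h₂ : S.IsSolution ξ₂ u₂ D₂ x₂) (t : ℝ) (ht : 0 ≤ t),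
        ‖History.segment x₁ h₁.continuousOn t ht - History.segment x₂ h₂.continuousOn t ht‖ ≤
          max (β ‖ξ₁ - ξ₂‖ t)
            (γU (essNorm (fun s => u₁ s - u₂ s) (Ico (-S.r) (t - S.r))) +
              γD (essNorm (fun s => D₁ s - D₂ s) (Ico 0 t)))

/-! ## Lyapunov–Krasovskii functionals -/

/-- The bound `B_X = max {β(BX0, 0), γ(BU)}` on all solutions that results from the gains `β`, `γ`
of the input-to-state stability estimate. -/
def BX (β : ℝ → ℝ → ℝ) (γ : ℝ → ℝ) : ℝ := max (β S.BX0 0) (γ S.BU)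

/-- The constant `L = max {M1, sup ‖f (x, y, u)‖}`, with the supremum over `‖x‖, ‖y‖ ≤ BX` and
`‖u‖ ≤ BU`. -/
def speedBound (BX : ℝ) : ℝ :=
  max S.M1 (sSup {c : ℝ | ∃ x y u, ‖x‖ ≤ BX ∧ ‖y‖ ≤ BX ∧ ‖u‖ ≤ S.BU ∧ c = ‖S.f x y u‖})

/-- The supremum in `speedBound` is a genuine one. -/
theorem bddAbove_speed (BX : ℝ) :
    BddAbove {c : ℝ | ∃ x y u, ‖x‖ ≤ BX ∧ ‖y‖ ≤ BX ∧ ‖u‖ ≤ S.BU ∧ c = ‖S.f x y u‖} := by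
  obtain ⟨κ, hκ, h⟩ := S.f_lipschitz (Metric.closedBall 0 (max |BX| S.BU)) Metric.isBounded_closedBall
  refine ⟨κ * (BX + BX + S.BU), ?_⟩
  rintro c ⟨x, y, u, hx, hy, hu, rfl⟩
  have hBU := S.BU_pos
  have h1 := h x y u 0 0 0
    (by
      have := le_abs_self BX
      simp only [mem_closedBall_zero_iff, Prod.norm_def, sup_le_iff]
      exact ⟨le_max_of_le_left (by linarith), le_max_of_le_left (by linarith),
        le_max_of_le_right hu⟩)
    (by simp [Prod.norm_def])
  rw [S.f_zero] at h1
  simp only [sub_zero] at h1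
  refine h1.trans ?_
  gcongr

/-- The upper right-hand derivative `D⁺V(t, x₁, x₂, u₁, u₂, d)`, an extended real number, for the
delay signal `D`. -/
def upperDeriv (D : ℝ → ℝ) (V : ℝ → S.Hist → S.Hist → ℝ) (t : ℝ) (x₁ x₂ : S.Hist)
    (u₁ u₂ : Fin m → ℝ) (d : Fin n → ℝ) : EReal :=
  limsup (fun θ : ℝ =>
    (((V (t + θ)
        (x₁.advance S.delayMax_nonneg (S.f (S.ev x₁ 0) (S.ev x₁ (-D t) + d) u₁) θ)
        (x₂.advance S.delayMax_nonneg (S.f (S.ev x₂ 0) (S.ev x₂ (-D t)) u₂) θ)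
      - V t x₁ x₂) / θ : ℝ) : EReal)) (𝓝[>] 0)

/-- `V` is an incremental input-delay-to-state stability Lyapunov–Krasovskii functional, relative
to the bound `BX` on the states. The functional `V D t x₁ x₂` may depend on the delay signal `D`,
as `D⁺V` does; the comparison functions and `Ma` must not. A functional that does not involve the
delay signal is the special case in which `V` is constant in `D`. -/
def IsLKF (BX : ℝ) (V : (ℝ → ℝ) → ℝ → S.Hist → S.Hist → ℝ) : Prop :=
  (∀ D, S.IsDelay D → LocallyLipschitzOn (Ici (0 : ℝ) ×ˢ (univ : Set (S.Hist × S.Hist)))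
    fun p : ℝ × S.Hist × S.Hist => V D p.1 p.2.1 p.2.2) ∧
  ∃ (α₁ α₂ α₃ ρ γlow γup : ℝ → ℝ) (Ma : S.Hist → ℝ),
    ClassKInf α₁ ∧ ClassKInf α₂ ∧ ClassK α₃ ∧ ClassK ρ ∧ ClassKInf γlow ∧ ClassKInf γup ∧
    Continuous Ma ∧
    (∀ x : S.Hist, γlow ‖S.ev x 0‖ ≤ Ma x ∧ Ma x ≤ γup ‖x‖) ∧
    ∀ D, S.IsDelay D →
      (∀ t, 0 ≤ t → ∀ x₁ x₂ : S.Hist,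
        α₁ ‖S.ev x₁ 0 - S.ev x₂ 0‖ ≤ V D t x₁ x₂ ∧ V D t x₁ x₂ ≤ α₂ (Ma (x₁ - x₂))) ∧
      (∀ (x₁ x₂ : S.Hist) (u₁ u₂ : Fin m → ℝ) (d : Fin n → ℝ),
        (∀ s, ‖x₁ s‖ ≤ BX) → (∀ s, ‖x₂ s‖ ≤ BX) → ‖u₁‖ ≤ S.BU → ‖u₂‖ ≤ S.BU →
        ‖d‖ ≤ S.speedBound BX * (S.delayMax - S.delayMin) →
        ρ ‖(u₁ - u₂, d)‖ ≤ Ma (x₁ - x₂) →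
        ∀ᵐ t ∂(volume.restrict (Ici (0 : ℝ))),
          S.upperDeriv D (V D) t x₁ x₂ u₁ u₂ d ≤ ((-α₃ (Ma (x₁ - x₂)) : ℝ) : EReal))

end TimeDelaySystem

end

/-!
Along a pair of solutions, let `W(t) = V(t, (x₁)_t, (x₂)_t)`, where `V` belongs to the delay signal
`D₂` of the second solution. The first solution is a solution for the delay `D₂` as well, up to the
disturbance `d(t) = x₁(t - D₁(t)) - x₁(t - D₂(t))` of the delayed state. By input-to-state stability
both solutions stay in the ball of radius `BX`, hence move with speed at most `L = speedBound BX`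
(`IsSolution.norm_sub_le_speedBound`), so that `‖d(t)‖ ≤ L |D₁(t) - D₂(t)|`. Thus all disturbances
are bounded by `c = max (‖u₁ - u₂‖, (L + 1) ‖D₁ - D₂‖)`. While `W > α₂(ρ(c))`, the decay condition
should give `W' ≤ -α₃(α₂⁻¹(W))`, and a comparison argument yields the estimate.

The decay condition cannot be inserted directly: it holds for fixed histories and almost every time,
and the exceptional set of times depends on the histories, which change along the solutions. The
remedy is to shift the explicit time argument only. For fixed `t`, the condition for the histories
`(x₁)_t`, `(x₂)_t` holds at the time `t + s` for almost every `s > 0`. Hence the average of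
`V(t + s, (x₁)_t, (x₂)_t)` over `s ∈ [0, ε]`, which is Lipschitz in `t`, decreases at the expected
rate up to an error `O(ε)`, which comes from evaluating the delay at `t + s` instead of `t`; then
`ε → 0`. This is `LipschitzWith.diagonal_sub_le`, applied in `IsSolution.functional_sub_le`.

The comparison argument `add_mul_le_of_decay` uses only that, with `α = α₃ ∘ α₂⁻¹`, a function
decreasing at rate `α(y)` above each level `y` satisfies `W(t) + t α(W(t)) ≤ W(0)`; the inverse of
`y ↦ y + t α(y)` is of class `KL` (`ClassK.exists_classKL`). The resulting bound on
`‖x₁(s) - x₂(s)‖` passes to segments at the price of a delay by `delayMax` in the second argument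
of the `KL` function.
-/

open scoped NNReal

/-! ### Comparison functions -/

namespace ClassK

theorem nonneg {g : ℝ → ℝ} (hg : ClassK g) {x : ℝ} (hx : 0 ≤ x) : 0 ≤ g x := by
  rw [← hg.map_zero]
  exact hg.strictMonoOn.monotoneOn self_mem_Ici hx hx

theorem pos {g : ℝ → ℝ} (hg : ClassK g) {x : ℝ} (hx : 0 < x) : 0 < g x := by
  rw [← hg.map_zero]
  exact hg.strictMonoOn self_mem_Ici hx.le hx

theorem mono {g : ℝ → ℝ} (hg : ClassK g) {x y : ℝ} (hx : 0 ≤ x) (hxy : x ≤ y) : g x ≤ g y :=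
  hg.strictMonoOn.monotoneOn hx (hx.trans hxy) hxy

theorem comp {g k : ℝ → ℝ} (hg : ClassK g) (hk : ClassK k) : ClassK fun x => g (k x) where
  continuousOn := hg.continuousOn.comp hk.continuousOn fun _ hx => hk.nonneg hx
  strictMonoOn _ hx _ hy hxy :=
    hg.strictMonoOn (hk.nonneg hx) (hk.nonneg hy) (hk.strictMonoOn hx hy hxy)
  map_zero := by rw [hk.map_zero, hg.map_zero]

theorem add {g k : ℝ → ℝ} (hg : ClassK g) (hk : ClassK k) : ClassK fun x => g x + k x where
  continuousOn := hg.continuousOn.add hk.continuousOn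
  strictMonoOn _ hx _ hy hxy :=
    add_lt_add (hg.strictMonoOn hx hy hxy) (hk.strictMonoOn hx hy hxy)
  map_zero := by rw [hk.map_zero, hg.map_zero, add_zero]

theorem const_mul_id {c : ℝ} (hc : 0 < c) : ClassK fun x => c * x where
  continuousOn := by fun_prop
  strictMonoOn _ _ _ _ hxy := mul_lt_mul_of_pos_left hxy hc
  map_zero := mul_zero c

end ClassK

/-- A function of class `K∞` has an inverse on `[0, ∞)`, again of class `K`. -/
theorem ClassKInf.exists_inverse {g : ℝ → ℝ} (hg : ClassKInf g) :
    ∃ k : ℝ → ℝ, ClassK k ∧ (∀ x, 0 ≤ x → k (g x) = x) ∧ ∀ x, 0 ≤ x → g (k x) = x := by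
  -- Extended by the identity to negative arguments, `g` becomes an order isomorphism of `ℝ`.
  let G : ℝ → ℝ := fun x => g (max x 0) + min x 0
  have hmono : StrictMono G := by
    intro x y hxy
    rcases le_or_gt y 0 with hy | hy
    · simpa [G, max_eq_right hy, max_eq_right (hxy.le.trans hy), min_eq_left hy,
        min_eq_left (hxy.le.trans hy)] using hxy
    · have h1 : min x 0 ≤ min y 0 := min_le_min_right _ hxy.le
      have h2 : g (max x 0) < g (max y 0) :=
        hg.strictMonoOn (mem_Ici.2 (le_max_right _ _)) (mem_Ici.2 (le_max_right _ _))
          (by rw [max_eq_left hy.le]; exact max_lt hxy hy)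
      exact add_lt_add_of_lt_of_le h2 h1
  have hcont : Continuous G := by
    have : Continuous fun x : ℝ => g (max x 0) :=
      hg.continuousOn.comp_continuous (by fun_prop) fun x => le_max_right x 0
    exact this.add (by fun_prop)
  have htop : Tendsto G atTop atTop := by
    refine hg.tendsto_atTop.congr' ?_
    filter_upwards [eventually_ge_atTop 0] with x hx
    simp [G, hx]
  have hbot : Tendsto G atBot atBot := by
    refine tendsto_id.congr' ?_
    filter_upwards [eventually_le_atBot 0] with x hx
    simp [G, hx, hg.map_zero]
  let e := hmono.orderIsoOfSurjective G (hcont.surjective htop hbot)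
  have he : ∀ x, e x = G x := fun x => rfl
  have hG : ∀ x, 0 ≤ x → G x = g x := fun x hx => by simp [G, hx]
  have h0 : e.symm 0 = 0 := by
    rw [OrderIso.symm_apply_eq, he, hG 0 le_rfl, hg.map_zero]
  refine ⟨e.symm, ⟨e.symm.continuous.continuousOn, e.symm.strictMono.strictMonoOn _, h0⟩,
    fun x hx => ?_, fun x hx => ?_⟩
  · rw [← hG x hx, ← he, OrderIso.symm_apply_apply]
  · have : 0 ≤ e.symm x := h0 ▸ e.symm.monotone hx
    rw [← hG _ this, ← he, OrderIso.apply_symm_apply]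

/-- The value at `w` of the inverse of `y ↦ y + t α(y)`. -/
theorem ClassK.exists_add_mul_eq {α : ℝ → ℝ} (hα : ClassK α) {w t : ℝ} (hw : 0 ≤ w)
    (ht : 0 ≤ t) : ∃ y, 0 ≤ y ∧ y ≤ w ∧ y + t * α y = w := by
  have hc : ContinuousOn (fun y => y + t * α y) (Icc 0 w) :=
    continuousOn_id.add (continuousOn_const.mul (hα.continuousOn.mono Icc_subset_Ici_self))
  have := intermediate_value_Icc hw hc
  obtain ⟨y, hy, h⟩ := this (show w ∈ _ from
    ⟨by simpa [hα.map_zero] using hw, by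
      have := mul_nonneg ht (hα.nonneg hw)
      simpa using this⟩)
  exact ⟨y, hy.1, hy.2, h⟩

/-- A quantity that decreases at rate at least `α(y)` as long as it exceeds `y` satisfies
`y + t α(y) ≤ w`, where `w` is its initial value and `y` its value at time `t`. Such a `y` is
bounded by a function of class `KL`, namely the inverse of `y ↦ y + t α(y)`; in contrast to the
flow of `y' = -α(y)`, this is available for continuous `α` without solving an equation. -/
theorem ClassK.exists_classKL {α : ℝ → ℝ} (hα : ClassK α) :
    ∃ b : ℝ → ℝ → ℝ, ClassKL b ∧
      ∀ w t y, 0 ≤ w → 0 ≤ t → 0 ≤ y → y + t * α y ≤ w → y ≤ b w t := by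
  have hex : ∀ w t : ℝ, ∃ y, 0 ≤ w → 0 ≤ t → 0 ≤ y ∧ y ≤ w ∧ y + t * α y = w := by
    intro w t
    by_cases h : 0 ≤ w ∧ 0 ≤ t
    · obtain ⟨y, hy⟩ := hα.exists_add_mul_eq h.1 h.2
      exact ⟨y, fun _ _ => hy⟩
    · exact ⟨0, fun h1 h2 => (h ⟨h1, h2⟩).elim⟩
  choose b hb using hex
  have b0 : ∀ {w t}, 0 ≤ w → 0 ≤ t → 0 ≤ b w t := fun hw ht => (hb _ _ hw ht).1
  have bw : ∀ {w t}, 0 ≤ w → 0 ≤ t → b w t ≤ w := fun hw ht => (hb _ _ hw ht).2.1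
  have be : ∀ {w t}, 0 ≤ w → 0 ≤ t → b w t + t * α (b w t) = w :=
    fun hw ht => (hb _ _ hw ht).2.2
  have key : ∀ w t y, 0 ≤ w → 0 ≤ t → 0 ≤ y → y + t * α y ≤ w → y ≤ b w t := by
    intro w t y hw ht hy h
    by_contra! hlt
    have := mul_le_mul_of_nonneg_left (hα.mono (b0 hw ht) hlt.le) ht
    linarith [be hw ht]
  have mono1 : ∀ {w w' t}, 0 ≤ w → w ≤ w' → 0 ≤ t → b w t ≤ b w' t := fun hw hww ht =>
    key _ _ _ (hw.trans hww) ht (b0 hw ht) ((be hw ht).le.trans hww)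
  have anti : ∀ {w t t'}, 0 ≤ w → 0 ≤ t → t ≤ t' → b w t' ≤ b w t := by
    intro w t t' hw ht htt
    refine key _ _ _ hw ht (b0 hw (ht.trans htt)) ?_
    have := mul_le_mul_of_nonneg_right htt (hα.nonneg (b0 hw (ht.trans htt)))
    linarith [be hw (ht.trans htt)]
  -- `b` is nonexpansive in the first argument and locally Lipschitz in the second.
  have lip1 : ∀ {w w' t}, 0 ≤ w → w ≤ w' → 0 ≤ t → b w' t - b w t ≤ w' - w := by
    intro w w' t hw hww ht
    have := mul_le_mul_of_nonneg_left (hα.mono (b0 hw ht) (mono1 hw hww ht)) ht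
    linarith [be hw ht, be (hw.trans hww) ht]
  have lip2 : ∀ {w t t'}, 0 ≤ w → 0 ≤ t → t ≤ t' → b w t - b w t' ≤ (t' - t) * α w := by
    intro w t t' hw ht htt
    have ht' := ht.trans htt
    have h1 := mul_le_mul_of_nonneg_left (hα.mono (b0 hw ht') (anti hw ht htt)) ht
    have h2 := mul_le_mul_of_nonneg_left (hα.mono (b0 hw ht') (bw hw ht')) (sub_nonneg.2 htt)
    linarith [be hw ht, be hw ht']
  have abs1 : ∀ {w w' t}, 0 ≤ w → 0 ≤ w' → 0 ≤ t → |b w t - b w' t| ≤ |w - w'| := by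
    intro w w' t hw hw' ht
    rcases le_total w w' with h | h
    · rw [abs_sub_comm, abs_sub_comm w, abs_of_nonneg (sub_nonneg.2 (mono1 hw h ht)),
        abs_of_nonneg (sub_nonneg.2 h)]
      exact lip1 hw h ht
    · rw [abs_of_nonneg (sub_nonneg.2 (mono1 hw' h ht)), abs_of_nonneg (sub_nonneg.2 h)]
      exact lip1 hw' h ht
  have abs2 : ∀ {w t t'}, 0 ≤ w → 0 ≤ t → 0 ≤ t' → |b w t - b w t'| ≤ |t - t'| * α w := by
    intro w t t' hw ht ht'
    rcases le_total t t' with h | h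
    · rw [abs_of_nonneg (sub_nonneg.2 (anti hw ht h)), abs_sub_comm t,
        abs_of_nonneg (sub_nonneg.2 h)]
      exact lip2 hw ht h
    · rw [abs_sub_comm, abs_of_nonneg (sub_nonneg.2 (anti hw ht' h)),
        abs_of_nonneg (sub_nonneg.2 h)]
      exact lip2 hw ht' h
  have cont : ContinuousOn (fun p : ℝ × ℝ => b p.1 p.2) (Ici 0 ×ˢ Ici 0) := by
    rintro ⟨w, t⟩ ⟨hw, ht⟩
    have hlim : Tendsto (fun p : ℝ × ℝ => |p.1 - w| + |p.2 - t| * α w)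
        (𝓝[Ici 0 ×ˢ Ici 0] (w, t)) (𝓝 0) := by
      have : Continuous fun p : ℝ × ℝ => |p.1 - w| + |p.2 - t| * α w := by fun_prop
      simpa using (this.tendsto (w, t)).mono_left nhdsWithin_le_nhds
    refine tendsto_iff_dist_tendsto_zero.2
      (squeeze_zero' (Eventually.of_forall fun _ => dist_nonneg) ?_ hlim)
    filter_upwards [self_mem_nhdsWithin] with p hp
    rw [Real.dist_eq]
    calc |b p.1 p.2 - b w t| ≤ |b p.1 p.2 - b w p.2| + |b w p.2 - b w t| := abs_sub_le _ _ _
      _ ≤ _ := add_le_add (abs1 hp.1 hw hp.2) (abs2 hw hp.2 ht)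
  refine ⟨b, ⟨cont, fun t ht => ⟨?_, ?_, ?_⟩, fun w hw t ht t' ht' h => anti hw ht h, ?_⟩, key⟩
  · exact cont.comp (f := fun w => ((w, t) : ℝ × ℝ)) (by fun_prop) fun w hw => ⟨hw, ht⟩
  · intro w hw w' hw' h
    refine lt_of_le_of_ne (mono1 hw h.le ht) fun heq => ?_
    have h1 := be hw ht
    have heq' : b w t = b w' t := heq
    rw [heq', be hw' ht] at h1
    exact h.ne' h1
  · exact le_antisymm (bw le_rfl ht) (b0 le_rfl ht)
  · intro w hw
    -- Otherwise `b w t ≥ ε` for large `t`, and `t α(ε) ≤ w` for all of them.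
    refine Metric.tendsto_atTop.2 fun ε hε => ⟨w / α ε + 1, fun t ht => ?_⟩
    have hpos := hα.pos hε
    have ht0 : 0 ≤ t := (by positivity : 0 ≤ w / α ε + 1).trans ht
    rw [Real.dist_eq, sub_zero, abs_of_nonneg (b0 hw ht0)]
    by_contra! hge
    have h1 := mul_le_mul_of_nonneg_left (hα.mono hε.le hge) ht0
    have h2 := mul_le_mul_of_nonneg_right ht hpos.le
    rw [add_mul, div_mul_cancel₀ _ hpos.ne'] at h2
    linarith [be hw ht0, b0 hw ht0]

namespace ClassKL

theorem nonneg {b : ℝ → ℝ → ℝ} (hb : ClassKL b) {w t : ℝ} (hw : 0 ≤ w) (ht : 0 ≤ t) :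
    0 ≤ b w t :=
  (hb.classK t ht).nonneg hw

theorem comp {b : ℝ → ℝ → ℝ} (hb : ClassKL b) {g k : ℝ → ℝ} (hg : ClassK g) (hk : ClassK k) :
    ClassKL fun w t => g (b (k w) t) where
  continuousOn := by
    refine hg.continuousOn.comp (hb.continuousOn.comp
      (f := fun p : ℝ × ℝ => (k p.1, p.2)) ?_ fun p hp => ⟨hk.nonneg hp.1, hp.2⟩)
      fun p hp => hb.nonneg (hk.nonneg hp.1) hp.2
    exact (hk.continuousOn.comp continuousOn_fst fun p hp => hp.1).prodMk continuousOn_snd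
  classK t ht := hg.comp ((hb.classK t ht).comp hk)
  antitoneOn w hw t ht t' ht' h :=
    hg.mono (hb.nonneg (hk.nonneg hw) ht') (hb.antitoneOn _ (hk.nonneg hw) ht ht' h)
  tendsto_zero w hw := by
    have h1 : Tendsto g (𝓝[≥] 0) (𝓝 0) := by
      simpa [ContinuousWithinAt, hg.map_zero] using hg.continuousOn 0 self_mem_Ici
    refine h1.comp (tendsto_nhdsWithin_iff.2 ⟨hb.tendsto_zero _ (hk.nonneg hw), ?_⟩)
    filter_upwards [eventually_ge_atTop 0] with t ht
    exact hb.nonneg (hk.nonneg hw) ht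

theorem add {b c : ℝ → ℝ → ℝ} (hb : ClassKL b) (hc : ClassKL c) :
    ClassKL fun w t => b w t + c w t where
  continuousOn := hb.continuousOn.add hc.continuousOn
  classK t ht := (hb.classK t ht).add (hc.classK t ht)
  antitoneOn w hw := (hb.antitoneOn w hw).add (hc.antitoneOn w hw)
  tendsto_zero w hw := by simpa using (hb.tendsto_zero w hw).add (hc.tendsto_zero w hw)

/-- Delaying the second argument by `h`. -/
theorem delay {b : ℝ → ℝ → ℝ} (hb : ClassKL b) (h : ℝ) :
    ClassKL fun w t => b w (max (t - h) 0) where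
  continuousOn := hb.continuousOn.comp (f := fun p : ℝ × ℝ => (p.1, max (p.2 - h) 0))
    (by fun_prop) fun p hp => ⟨hp.1, mem_Ici.2 (le_max_right _ _)⟩
  classK t _ := hb.classK _ (le_max_right _ _)
  antitoneOn w hw t _ t' _ htt := hb.antitoneOn w hw (mem_Ici.2 (le_max_right _ _))
    (mem_Ici.2 (le_max_right _ _))
    (max_le_max_right _ (by linarith))
  tendsto_zero w hw := (hb.tendsto_zero w hw).comp
    (tendsto_atTop_mono (fun t => le_max_left _ _) (tendsto_atTop_add_const_right _ (-h) tendsto_id))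

theorem mul_exp_neg : ClassKL fun w t => Real.exp (-t) * w where
  continuousOn := by fun_prop
  classK t _ := ClassK.const_mul_id (Real.exp_pos _)
  antitoneOn w hw t _ t' _ h :=
    mul_le_mul_of_nonneg_right (Real.exp_le_exp.2 (neg_le_neg h)) hw
  tendsto_zero w _ := by
    simpa using (Real.tendsto_exp_neg_atTop_nhds_zero).mul_const w

end ClassKL

/-! ### Lipschitz functions and averaging -/

/-- The mean value inequality for absolutely continuous functions. -/
theorem AbsolutelyContinuousOnInterval.sub_le_mul_of_deriv_le {f : ℝ → ℝ} {a b A : ℝ}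
    (hab : a ≤ b) (hf : AbsolutelyContinuousOnInterval f a b)
    (h : ∀ᵐ t, t ∈ Ioo a b → ∀ f', HasDerivAt f f' t → f' ≤ A) : f b - f a ≤ A * (b - a) := by
  rw [← hf.integral_deriv_eq_sub]
  have hle : ∀ᵐ t ∂(volume.restrict (Icc a b)), deriv f t ≤ A := by
    rw [ae_restrict_congr_set Ioo_ae_eq_Icc.symm, ae_restrict_iff' measurableSet_Ioo]
    filter_upwards [h, hf.ae_differentiableAt] with t h1 h2 ht
    exact h1 ht _ (h2 (by rw [uIcc_of_le hab]; exact Ioo_subset_Icc_self ht)).hasDerivAt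
  calc ∫ t in a..b, deriv f t ≤ ∫ _ in a..b, A :=
        intervalIntegral.integral_mono_ae_restrict hab hf.intervalIntegrable_deriv
          intervalIntegrable_const hle
    _ = A * (b - a) := by simp [mul_comm]

/-- The comparison principle: a continuous function that decreases at rate `α(y)` on intervals
where it exceeds a level `y > k` satisfies `g T + T α(g T) ≤ g 0` if `g T > k`. -/
theorem add_mul_le_of_decay {α : ℝ → ℝ} (hα : ClassK α) {g : ℝ → ℝ} {T k : ℝ} (hT : 0 ≤ T)
    (hk : 0 ≤ k) (hg : ContinuousOn g (Icc 0 T))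
    (hdec : ∀ y, k < y → ∀ a, 0 ≤ a → a ≤ T → (∀ t ∈ Icc a T, y ≤ g t) →
      g T - g a ≤ -α y * (T - a))
    (hgT : k < g T) : g T + T * α (g T) ≤ g 0 := by
  have step : ∀ y, k < y → y < g T → g T + T * α y ≤ g 0 := by
    intro y hky hy
    -- Going back in time from `T`, the function never falls to the level `y`.
    have hall : ∀ t ∈ Icc 0 T, y ≤ g t := by
      by_contra! hne
      obtain ⟨t₁, ht₁, hlt⟩ := hne
      have hcl : IsClosed (Icc 0 T ∩ g ⁻¹' Iic y) := hg.preimage_isClosed_of_isClosed isClosed_Icc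
        isClosed_Iic
      have hcomp : IsCompact (Icc 0 T ∩ g ⁻¹' Iic y) :=
        isCompact_Icc.of_isClosed_subset hcl inter_subset_left
      obtain ⟨a, ⟨haI, hay⟩, hmax⟩ := hcomp.exists_isGreatest ⟨t₁, ht₁, hlt.le⟩
      have hgt : ∀ t, a < t → t ≤ T → y < g t := fun t hat htT => by
        by_contra! hle
        exact absurd (hmax ⟨⟨haI.1.trans hat.le, htT⟩, hle⟩) (not_le.2 hat)
      have haT : a < T := lt_of_le_of_ne haI.2 fun h => by
        rw [h] at hay
        exact absurd hay (not_le.2 hy)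
      have hge : y ≤ g a := by
        have hcl' : IsClosed (Icc 0 T ∩ g ⁻¹' Ici y) :=
          hg.preimage_isClosed_of_isClosed isClosed_Icc isClosed_Ici
        have : a ∈ closure (Ioc a T) := by
          rw [closure_Ioc haT.ne]
          exact left_mem_Icc.2 haT.le
        exact (closure_minimal (fun t ht =>
          (⟨⟨haI.1.trans ht.1.le, ht.2⟩, (hgt t ht.1 ht.2).le⟩ : t ∈ Icc 0 T ∩ g ⁻¹' Ici y))
          hcl' this).2
      have h1 := hdec y hky a haI.1 haI.2 fun t ht => by
        rcases ht.1.eq_or_lt with h | h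
        · rwa [← h]
        · exact (hgt t h ht.2).le
      have h2 := mul_nonneg (hα.nonneg (hk.trans hky.le)) (sub_nonneg.2 haI.2)
      have hay' : g a ≤ y := hay
      linarith
    have := hdec y hky 0 le_rfl hT hall
    linarith
  have hlim : Tendsto (fun y => g T + T * α y) (𝓝[<] (g T)) (𝓝 (g T + T * α (g T))) := by
    have : ContinuousAt α (g T) := hα.continuousOn.continuousAt (Ici_mem_nhds (hk.trans_lt hgT))
    exact (this.tendsto.mono_left nhdsWithin_le_nhds).const_mul T |>.const_add _
  refine le_of_tendsto hlim ?_
  filter_upwards [Ioo_mem_nhdsLT hgT] with y hy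
  exact step y hy.1 hy.2

/-- A locally Lipschitz function is Lipschitz, with uniform constants, near a compact set. -/
theorem LocallyLipschitzOn.exists_uniform {X : Type*} [PseudoMetricSpace X] {f : X → ℝ}
    {s Q : Set X} (hf : LocallyLipschitzOn s f) (hQ : IsCompact Q) (hQs : Q ⊆ s) :
    ∃ δ > 0, ∃ K : ℝ, 0 ≤ K ∧ ∀ p ∈ Q, ∀ q ∈ s, ∀ q' ∈ s, dist q p < δ → dist q' p < δ →
      |f q - f q'| ≤ K * dist q q' := by
  have hloc : ∀ x ∈ Q, ∃ ε > 0, ∃ K : ℝ≥0, ∀ q ∈ s, ∀ q' ∈ s, dist q x < ε → dist q' x < ε →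
      |f q - f q'| ≤ K * dist q q' := by
    intro x hx
    obtain ⟨K, t, ht, hK⟩ := hf (hQs hx)
    obtain ⟨ε, hε, hsub⟩ := Metric.mem_nhdsWithin_iff.1 ht
    exact ⟨ε, hε, K, fun q hq q' hq' h h' => by
      simpa [Real.dist_eq] using hK.dist_le_mul q (hsub ⟨h, hq⟩) q' (hsub ⟨h', hq'⟩)⟩
  choose! ε hε K hK using hloc
  obtain ⟨F, hFQ, hcov⟩ := hQ.elim_nhds_subcover (fun x => Metric.ball x (ε x / 2))
    fun x hx => Metric.ball_mem_nhds _ (half_pos (hε x hx))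
  rcases F.eq_empty_or_nonempty with rfl | hne
  · refine ⟨1, one_pos, 0, le_rfl, fun p hp => ?_⟩
    simpa using hcov hp
  refine ⟨F.inf' hne (fun x => ε x / 2), ?_, ((F.sup K : ℝ≥0) : ℝ), NNReal.coe_nonneg _, ?_⟩
  · rw [gt_iff_lt, Finset.lt_inf'_iff]
    exact fun x hx => half_pos (hε x (hFQ x hx))
  · intro p hp q hq q' hq' h h'
    obtain ⟨x, hxF, hx⟩ := mem_iUnion₂.1 (hcov hp)
    have hδ := Finset.inf'_le (fun x => ε x / 2) hxF
    have hx' : dist p x < ε x / 2 := hx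
    have h1 := hK x (hFQ x hxF) q hq q' hq' (by linarith [dist_triangle q p x])
      (by linarith [dist_triangle q' p x])
    refine h1.trans (mul_le_mul_of_nonneg_right ?_ dist_nonneg)
    exact_mod_cast Finset.le_sup (f := K) hxF

/-- If `G (t, t')` is Lipschitz and, for almost every `t` and then almost every small `s > 0`, its
upper right derivative in the direction `(1, 1)` at `(t + s, t)` is at most `A + E s`, then `G`
grows at most at rate `A` along the diagonal. Nothing is assumed on the diagonal itself, which may
consist of exceptional points: averaging over `s ∈ [0, ε]` removes the exceptional sets. -/
theorem LipschitzWith.diagonal_sub_le {G : ℝ × ℝ → ℝ} {K : ℝ≥0} (hG : LipschitzWith K G)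
    {a b A E : ℝ} (hab : a ≤ b) (hE : 0 ≤ E)
    (h : ∀ᵐ t, t ∈ Ioo a b → ∀ᵐ s, s ∈ Ioo (0 : ℝ) 1 → ∀ η > 0, ∀ᶠ θ in 𝓝[>] (0 : ℝ),
      G (t + s + θ, t + θ) - G (t + s, t) ≤ θ * (A + E * s + η)) :
    G (b, b) - G (a, a) ≤ A * (b - a) := by
  have hcont := hG.continuous
  have hGle : ∀ p q, |G p - G q| ≤ K * dist p q := fun p q => by
    simpa [Real.dist_eq] using hG.dist_le_mul p q
  have hint : ∀ (t ε : ℝ), IntervalIntegrable (fun s => G (t + s, t)) volume 0 ε := fun t ε =>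
    Continuous.intervalIntegrable (by fun_prop) _ _
  have main : ∀ ε, 0 < ε → ε ≤ 1 →
      G (b, b) - G (a, a) ≤ (A + E * ε) * (b - a) + 2 * K * ε := by
    intro ε hε hε1
    let W : ℝ → ℝ := fun t => ∫ s in (0 : ℝ)..ε, G (t + s, t)
    have hWlip : LipschitzWith (K * ε.toNNReal) W := by
      refine LipschitzWith.of_dist_le_mul fun t t' => ?_
      rw [Real.dist_eq, ← intervalIntegral.integral_sub (hint t ε) (hint t' ε)]
      have := intervalIntegral.norm_integral_le_of_norm_le_const (a := (0 : ℝ)) (b := ε)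
        (f := fun s => G (t + s, t) - G (t' + s, t')) (C := K * dist t t') fun s _ => by
          simpa [Prod.dist_eq] using hGle (t + s, t) (t' + s, t')
      rw [Real.norm_eq_abs, sub_zero, abs_of_pos hε] at this
      simpa [hε.le, mul_comm, mul_left_comm, mul_assoc] using this
    have hWsub : W b - W a ≤ (ε * (A + E * ε)) * (b - a) := by
      refine AbsolutelyContinuousOnInterval.sub_le_mul_of_deriv_le hab
        (hWlip.lipschitzOnWith.absolutelyContinuousOnInterval) ?_
      filter_upwards [h] with t ht htab f' hf'
      specialize ht htab
      set B := A + E * ε with hB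
      let q : ℝ → ℝ → ℝ := fun θ s => θ⁻¹ * (G (t + s + θ, t + θ) - G (t + s, t))
      have hqc : ∀ θ, Continuous (q θ) := fun θ => by fun_prop
      have hq : ∀ θ, 0 < θ → ∀ s, |q θ s| ≤ K := fun θ hθ s => by
        have := hGle (t + s + θ, t + θ) (t + s, t)
        simp only [Prod.dist_eq, dist_self_add_left, Real.norm_eq_abs, max_self,
          abs_of_pos hθ] at this
        simp only [q, abs_mul, abs_inv, abs_of_pos hθ]
        rw [inv_mul_le_iff₀ hθ, mul_comm θ]
        exact this
      have hslope : Tendsto (fun θ => ∫ s in (0 : ℝ)..ε, q θ s) (𝓝[>] 0) (𝓝 f') := by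
        refine hf'.tendsto_slope_zero_right.congr fun θ => ?_
        simp only [q, W, smul_eq_mul]
        rw [intervalIntegral.integral_const_mul, ← intervalIntegral.integral_sub (hint _ _)
          (hint _ _)]
        congr 2 with s
        congr 3
        ring
      -- The difference quotients, cut off below at `B`, converge to `B` boundedly.
      have hcut : Tendsto (fun θ => ∫ s in (0 : ℝ)..ε, max (q θ s) B) (𝓝[>] 0)
          (𝓝 (∫ _ in (0 : ℝ)..ε, B)) := by
        refine intervalIntegral.tendsto_integral_filter_of_dominated_convergence
          (fun _ => max (K : ℝ) |B|) ?_ ?_ intervalIntegrable_const ?_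
        · exact Eventually.of_forall fun θ =>
            ((hqc θ).max continuous_const).aestronglyMeasurable
        · filter_upwards [self_mem_nhdsWithin] with θ hθ
          refine Eventually.of_forall fun s _ => ?_
          exact abs_max_le_max_abs_abs.trans (max_le_max_right _ (hq θ hθ s))
        · have hne : ∀ᵐ s : ℝ, s ≠ 1 := by simp [ae_iff]
          filter_upwards [ht, hne] with s hs hs1 hsI
          rw [uIoc_of_le hε.le] at hsI
          have hs' := hs ⟨hsI.1, lt_of_le_of_ne (hsI.2.trans hε1) hs1⟩
          have hEs := mul_le_mul_of_nonneg_left hsI.2 hE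
          refine tendsto_order.2 ⟨fun c hc => Eventually.of_forall fun θ =>
            hc.trans_le (le_max_right _ _), fun c hc => ?_⟩
          filter_upwards [hs' ((c - B) / 2) (by linarith), self_mem_nhdsWithin] with θ h1 hθ
          refine max_lt ?_ hc
          have hθ' : (0 : ℝ) < θ := hθ
          have : q θ s ≤ A + E * s + (c - B) / 2 := (inv_mul_le_iff₀ hθ').2 h1
          linarith
      have hle : f' ≤ ∫ _ in (0 : ℝ)..ε, B := by
        refine le_of_tendsto_of_tendsto' hslope hcut fun θ => ?_
        exact intervalIntegral.integral_mono hε.le ((hqc θ).intervalIntegrable _ _)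
          (((hqc θ).max continuous_const).intervalIntegrable _ _) fun s => le_max_left _ _
      simpa using hle
    have hWG : ∀ t, |W t - ε * G (t, t)| ≤ K * ε * ε := fun t => by
      have h1 : ε * G (t, t) = ∫ _ in (0 : ℝ)..ε, G (t, t) := by simp
      rw [h1, ← intervalIntegral.integral_sub (hint t ε) intervalIntegrable_const]
      have := intervalIntegral.norm_integral_le_of_norm_le_const (a := (0 : ℝ)) (b := ε)
        (f := fun s => G (t + s, t) - G (t, t)) (C := K * ε) fun s hs => by
          rw [uIoc_of_le hε.le] at hs
          refine (hGle (t + s, t) (t, t)).trans ?_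
          have : dist (t + s, t) (t, t) = s := by
            simp [Prod.dist_eq, hs.1.le, abs_of_pos hs.1]
          rw [this]
          exact mul_le_mul_of_nonneg_left hs.2 K.2
      simpa [abs_of_pos hε] using this
    have h1 := abs_le.1 (hWG a)
    have h2 := abs_le.1 (hWG b)
    have h3 : ε * (G (b, b) - G (a, a)) ≤ ε * ((A + E * ε) * (b - a) + 2 * K * ε) := by
      linarith
    exact le_of_mul_le_mul_left h3 hε
  have hlim : Tendsto (fun ε : ℝ => (A + E * ε) * (b - a) + 2 * K * ε) (𝓝[>] 0)
      (𝓝 (A * (b - a))) := by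
    have : Continuous fun ε : ℝ => (A + E * ε) * (b - a) + 2 * K * ε := by fun_prop
    simpa using (this.tendsto 0).mono_left nhdsWithin_le_nhds
  refine ge_of_tendsto hlim ?_
  filter_upwards [Ioc_mem_nhdsGT (zero_lt_one' ℝ)] with ε hε
  exact main ε hε.1 hε.2

/-! ### Trajectories -/

theorem AbsolutelyContinuousOnInterval.apply {n : ℕ} {x : ℝ → Fin n → ℝ} {a b : ℝ}
    (hx : AbsolutelyContinuousOnInterval x a b) (i : Fin n) :
    AbsolutelyContinuousOnInterval (fun t => x t i) a b := by
  rw [absolutelyContinuousOnInterval_iff] at hx ⊢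
  intro ε hε
  obtain ⟨δ, hδ, h⟩ := hx ε hε
  refine ⟨δ, hδ, fun E hE hlt => lt_of_le_of_lt ?_ (h E hE hlt)⟩
  exact Finset.sum_le_sum fun j _ => dist_le_pi_dist _ _ i

/-- The curve of segments of `x` in the space of histories; frozen at its initial value for
negative times, so that it is defined on all of `ℝ`. -/
noncomputable def History.curve {h : ℝ} {n : ℕ} (x : ℝ → Fin n → ℝ)
    (hx : ContinuousOn x (Ici (-h))) (t : ℝ) : History h n :=
  History.segment x hx (max t 0) (le_max_right t 0)

namespace History

variable {h : ℝ} {n : ℕ} {x : ℝ → Fin n → ℝ} (hx : ContinuousOn x (Ici (-h)))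

theorem curve_of_nonneg {t : ℝ} (ht : 0 ≤ t) : curve x hx t = segment x hx t ht := by
  simp [curve, ht]

theorem curve_apply {t : ℝ} (ht : 0 ≤ t) (s : Icc (-h) (0 : ℝ)) : curve x hx t s = x (t + s) := by
  rw [curve_of_nonneg hx ht]
  rfl

theorem eval_curve (hh : 0 ≤ h) {t s : ℝ} (ht : 0 ≤ t) (hs : s ∈ Icc (-h) 0) :
    (curve x hx t).eval hh s = x (t + s) := by
  rw [eval_of_mem hh _ hs, curve_apply hx ht]

/-- If `x` has derivative `v` at `t`, its segments move, up to `o(θ)`, along the straight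
prolongations of slope `v`, and a different slope `w` costs at most `θ ‖v - w‖`. -/
theorem eventually_norm_curve_sub_advance_le (hh : 0 ≤ h) {t : ℝ} (ht : 0 ≤ t)
    {v : Fin n → ℝ} (hv : HasDerivAt x v t) {η : ℝ} (hη : 0 < η) :
    ∀ᶠ θ in 𝓝[>] (0 : ℝ), ∀ w : Fin n → ℝ,
      ‖curve x hx (t + θ) - (curve x hx t).advance hh w θ‖ ≤ θ * (η + ‖v - w‖) := by
  have ho : ∀ᶠ z in 𝓝 (0 : ℝ), ‖x (t + z) - x t - z • v‖ ≤ η * ‖z‖ :=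
    (hasDerivAt_iff_isLittleO_nhds_zero.1 hv).def hη
  obtain ⟨δ, hδ, hball⟩ := Metric.eventually_nhds_iff.1 ho
  filter_upwards [Ioo_mem_nhdsGT hδ] with θ hθ w
  have hθ0 : 0 ≤ θ := hθ.1.le
  have hC : 0 ≤ θ * (η + ‖v - w‖) := by positivity
  refine (ContinuousMap.norm_le _ hC).2 fun s => ?_
  rw [ContinuousMap.sub_apply, curve_apply hx (add_nonneg ht hθ0)]
  rcases lt_or_ge (s : ℝ) (-θ) with hs | hs
  · rw [advance_of_lt hh _ _ s hs,
      eval_curve hx hh ht ⟨by linarith [s.2.1], by linarith⟩]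
    have : t + θ + (s : ℝ) = t + (s + θ) := by ring
    rw [this, sub_self, norm_zero]
    exact hC
  · rw [advance_of_le hh _ _ s hs, eval_curve hx hh ht ⟨by linarith, le_rfl⟩]
    have h0 : 0 ≤ (s : ℝ) + θ := by linarith
    have h1 : (s : ℝ) + θ ≤ θ := by linarith [s.2.2]
    have h2 := hball (y := (s : ℝ) + θ) (by
      rw [Real.dist_eq, sub_zero, abs_of_nonneg h0]
      exact h1.trans_lt hθ.2)
    rw [Real.norm_eq_abs, abs_of_nonneg h0] at h2
    have h3 : x (t + θ + s) - (x (t + 0) + ((s : ℝ) + θ) • w) =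
        (x (t + (s + θ)) - x t - ((s : ℝ) + θ) • v) + ((s : ℝ) + θ) • (v - w) := by
      rw [add_zero, smul_sub, show t + θ + (s : ℝ) = t + (s + θ) by ring]
      abel
    rw [h3]
    refine (norm_add_le _ _).trans ?_
    rw [norm_smul, Real.norm_eq_abs, abs_of_nonneg h0]
    calc _ ≤ η * (s + θ) + (s + θ) * ‖v - w‖ := by gcongr
      _ = (s + θ) * (η + ‖v - w‖) := by ring
      _ ≤ _ := by gcongr

theorem lipschitzWith_curve {L : ℝ≥0}
    (hL : ∀ a b, -h ≤ a → -h ≤ b → ‖x a - x b‖ ≤ L * |a - b|) : LipschitzWith L (curve x hx) := by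
  refine LipschitzWith.of_dist_le_mul fun t t' => ?_
  refine (ContinuousMap.dist_le (by positivity)).2 fun s => ?_
  have hs := s.2.1
  have h1 := le_max_right t 0
  have h2 := le_max_right t' 0
  rw [dist_eq_norm]
  refine (hL (max t 0 + s) (max t' 0 + s) (by linarith) (by linarith)).trans ?_
  rw [add_sub_add_right_eq_sub, Real.dist_eq]
  exact mul_le_mul_of_nonneg_left (abs_max_sub_max_le_abs t t' 0) L.2

end History

namespace TimeDelaySystem

variable {n m : ℕ} {S : TimeDelaySystem n m}

theorem IsDelay.abs_sub_le {D : ℝ → ℝ} (hD : S.IsDelay D) {t t' : ℝ} (ht : 0 ≤ t)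
    (ht' : 0 ≤ t') : |D t - D t'| ≤ S.dMin * |t - t'| := by
  have := (convex_Ici (0 : ℝ)).norm_image_sub_le_of_norm_derivWithin_le
    (hD.contDiffOn.differentiableOn one_ne_zero) (C := S.dMin)
    (fun s hs => hD.deriv_bound s hs) ht' ht
  simpa using this

theorem IsDelay.sub_mem {D : ℝ → ℝ} (hD : S.IsDelay D) {t : ℝ} (ht : 0 ≤ t) :
    -S.delayMax ≤ t - D t := by
  linarith [(hD.mem t ht).2]

theorem IsDelay.neg_mem {D : ℝ → ℝ} (hD : S.IsDelay D) {t : ℝ} (ht : 0 ≤ t) :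
    -D t ∈ Icc (-S.delayMax) 0 :=
  ⟨by linarith [(hD.mem t ht).2], by linarith [(hD.mem t ht).1, S.delayMin_nonneg]⟩

theorem norm_f_le_speedBound {B : ℝ} {x y : Fin n → ℝ} {u : Fin m → ℝ} (hx : ‖x‖ ≤ B)
    (hy : ‖y‖ ≤ B) (hu : ‖u‖ ≤ S.BU) : ‖S.f x y u‖ ≤ S.speedBound B :=
  (le_csSup (S.bddAbove_speed B) ⟨x, y, u, hx, hy, hu, rfl⟩).trans (le_max_right _ _)

theorem speedBound_nonneg (B : ℝ) : 0 ≤ S.speedBound B := S.M1_nonneg.trans (le_max_left _ _)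

theorem essNorm_nonneg {E : Type*} [NormedAddCommGroup E] (g : ℝ → E) (I : Set ℝ) :
    0 ≤ essNorm g I := ENNReal.toReal_nonneg

theorem essNorm_le {E : Type*} [NormedAddCommGroup E] {g : ℝ → E} {I : Set ℝ} {c : ℝ}
    (hI : MeasurableSet I) (hc : 0 ≤ c) (h : ∀ t ∈ I, ‖g t‖ ≤ c) : essNorm g I ≤ c := by
  refine ENNReal.toReal_le_of_le_ofReal hc (eLpNormEssSup_le_of_ae_bound ?_)
  exact (ae_restrict_iff' hI).2 (Eventually.of_forall h)

/-- The essential supremum norm of a bounded function is an almost everywhere bound. -/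
theorem ae_norm_le_essNorm {E : Type*} [NormedAddCommGroup E] {g : ℝ → E} {I : Set ℝ} {c : ℝ}
    (hI : MeasurableSet I) (h : ∀ t ∈ I, ‖g t‖ ≤ c) :
    ∀ᵐ t, t ∈ I → ‖g t‖ ≤ essNorm g I := by
  have hfin : eLpNormEssSup g (volume.restrict I) ≠ ⊤ := by
    refine ne_top_of_le_ne_top ENNReal.ofReal_ne_top
      (eLpNormEssSup_le_of_ae_bound (C := c) ((ae_restrict_iff' hI).2 (Eventually.of_forall h)))
  refine (ae_restrict_iff' hI).1 ?_
  filter_upwards [enorm_ae_le_eLpNormEssSup g (volume.restrict I)] with t ht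
  rw [essNorm, ← toReal_enorm]
  exact ENNReal.toReal_mono hfin ht

theorem IsSolution.norm_le {βISS : ℝ → ℝ → ℝ} {γISS : ℝ → ℝ} (hISS : S.ISSWith βISS γISS)
    {ξ : S.Hist} {u : ℝ → Fin m → ℝ} {D : ℝ → ℝ} {x : ℝ → Fin n → ℝ}
    (hx : S.IsSolution ξ u D x) (hξ : ‖ξ‖ ≤ S.BX0) (hu : S.IsInput u) (hD : S.IsDelay D)
    {t : ℝ} (ht : -S.delayMax ≤ t) : ‖x t‖ ≤ S.BX βISS γISS := by
  have key : ∀ (τ : ℝ) (hτ : 0 ≤ τ),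
      ‖History.segment x hx.continuousOn τ hτ‖ ≤ S.BX βISS γISS := by
    intro τ hτ
    refine (hISS.estimate ξ u D hu hD x hx τ hτ).trans (max_le_max ?_ ?_)
    · exact (hISS.classKL.antitoneOn _ (norm_nonneg ξ) self_mem_Ici hτ hτ).trans
        ((hISS.classKL.classK 0 le_rfl).mono (norm_nonneg ξ) hξ)
    · exact hISS.classK.mono (essNorm_nonneg _ _)
        (essNorm_le measurableSet_Ico S.BU_pos.le fun s hs => hu.bound s hs.1)
  rcases le_total 0 t with h0 | h0
  · refine le_trans ?_ (key t h0)
    simpa [History.segment] using (History.segment x hx.continuousOn t h0).norm_coe_le_norm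
      ⟨0, neg_nonpos.2 S.delayMax_nonneg, le_rfl⟩
  · refine le_trans ?_ (key 0 le_rfl)
    simpa [History.segment] using (History.segment x hx.continuousOn 0 le_rfl).norm_coe_le_norm
      ⟨t, ht, h0⟩

/-- Solutions with values in the ball of radius `B` and an admissible initial history move with
speed at most `speedBound B`. -/
theorem IsSolution.norm_sub_le_speedBound {B : ℝ} {ξ : S.Hist} {u : ℝ → Fin m → ℝ} {D : ℝ → ℝ}
    {x : ℝ → Fin n → ℝ} (hx : S.IsSolution ξ u D x) (hξ : S.IsInitial ξ) (hu : S.IsInput u)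
    (hD : S.IsDelay D) (hB : ∀ t, -S.delayMax ≤ t → ‖x t‖ ≤ B) (a b : ℝ)
    (ha : -S.delayMax ≤ a) (hb : -S.delayMax ≤ b) :
    ‖x a - x b‖ ≤ S.speedBound B * |a - b| := by
  set L := S.speedBound B with hL
  have hneg : ∀ a b, -S.delayMax ≤ a → a ≤ b → b ≤ 0 → ‖x a - x b‖ ≤ L * |a - b| := by
    intro a b ha hab hb
    have hmem : ∀ c, -S.delayMax ≤ c → c ≤ 0 → x c = S.ev ξ c := fun c h1 h2 => by
      rw [ev, History.eval_of_mem _ _ ⟨h1, h2⟩]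
      exact hx.initial ⟨c, h1, h2⟩
    rw [hmem a ha (hab.trans hb), hmem b (ha.trans hab) hb]
    have := (convex_Icc (-S.delayMax) (0 : ℝ)).norm_image_sub_le_of_norm_derivWithin_le
      (hξ.contDiffOn.differentiableOn one_ne_zero) hξ.deriv_bound
      ⟨ha.trans hab, hb⟩ ⟨ha, hab.trans hb⟩
    exact this.trans (mul_le_mul_of_nonneg_right (le_max_left _ _) (norm_nonneg _))
  have hpos : ∀ a b, 0 ≤ a → a ≤ b → ‖x a - x b‖ ≤ L * |a - b| := by
    intro a b ha hab
    have hb := ha.trans hab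
    have hder := (ae_restrict_iff' measurableSet_Ici).1 hx.equation
    have hbound : ∀ t, 0 ≤ t → ‖S.f (x t) (x (t - D t)) (u (t - S.r))‖ ≤ L := fun t ht =>
      norm_f_le_speedBound (hB t (by linarith [S.delayMax_nonneg])) (hB _ (hD.sub_mem ht))
        (hu.bound _ (by linarith))
    have hAC := (hx.absolutelyContinuous b hb).mono (c := a) (d := b) (by
      rw [uIcc_of_le hab, uIcc_of_le hb]
      exact Icc_subset_Icc_left ha)
    refine (pi_norm_le_iff_of_nonneg (by have := S.speedBound_nonneg B; positivity)).2
      fun i => ?_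
    rw [abs_sub_comm a b, abs_of_nonneg (sub_nonneg.2 hab), Pi.sub_apply, norm_sub_rev,
      Real.norm_eq_abs, abs_le']
    constructor
    · refine (hAC.apply i).sub_le_mul_of_deriv_le hab ?_
      filter_upwards [hder] with t ht htI f' hf'
      have ht0 : 0 ≤ t := ha.trans htI.1.le
      rw [hf'.unique (hasDerivAt_pi.1 (ht ht0) i)]
      exact (le_abs_self _).trans ((norm_le_pi_norm _ i).trans (hbound t ht0))
    · have := (hAC.apply i).neg.sub_le_mul_of_deriv_le (A := L) hab (by
        filter_upwards [hder] with t ht htI f' hf'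
        have ht0 : 0 ≤ t := ha.trans htI.1.le
        rw [hf'.unique (hasDerivAt_pi.1 (ht ht0) i).neg]
        exact (neg_le_abs _).trans ((norm_le_pi_norm _ i).trans (hbound t ht0)))
      simp only [Pi.neg_apply] at this
      linarith
  wlog hab : a ≤ b generalizing a b
  · rw [norm_sub_rev, abs_sub_comm]
    exact this b a hb ha (le_of_not_ge hab)
  rcases le_total b 0 with hb0 | hb0
  · exact hneg a b ha hab hb0
  rcases le_total 0 a with ha0 | ha0
  · exact hpos a b ha0 hab
  · have h1 := hneg a 0 ha ha0 le_rfl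
    have h2 := hpos 0 b le_rfl hb0
    rw [abs_of_nonpos (by linarith)] at h1 h2 ⊢
    calc ‖x a - x b‖ ≤ ‖x a - x 0‖ + ‖x 0 - x b‖ := norm_sub_le_norm_sub_add_norm_sub _ _ _
      _ ≤ _ := add_le_add h1 h2
      _ = _ := by ring

end TimeDelaySystem

/-! ### Decay of the functional along pairs of solutions -/

namespace TimeDelaySystem

variable {n m : ℕ} {S : TimeDelaySystem n m}

/-- Along two solutions, the functional for the delay signal of the second one decreases at rate
`A` over a time interval on which `α₃ (Ma (x₁ - x₂)) ≥ A` and `Ma (x₁ - x₂)` dominates the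
mismatch of the inputs and of the delayed states. The decay condition is assumed for fixed
histories and almost all times, so it may fail at all pairs `(t, (x₁)_t, (x₂)_t)`; it is used
at `(t + s, (x₁)_t, (x₂)_t)` for almost every small `s > 0`. -/
theorem IsSolution.functional_sub_le {B : ℝ} {V : ℝ → S.Hist → S.Hist → ℝ} {α₃ ρ : ℝ → ℝ}
    {Ma : S.Hist → ℝ} {ξ₁ ξ₂ : S.Hist} {u₁ u₂ : ℝ → Fin m → ℝ} {D₁ D₂ : ℝ → ℝ}
    {x₁ x₂ : ℝ → Fin n → ℝ} (h₁ : S.IsSolution ξ₁ u₁ D₁ x₁) (h₂ : S.IsSolution ξ₂ u₂ D₂ x₂)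
    (hξ₁ : S.IsInitial ξ₁) (hξ₂ : S.IsInitial ξ₂) (hu₁ : S.IsInput u₁) (hu₂ : S.IsInput u₂)
    (hD₁ : S.IsDelay D₁) (hD₂ : S.IsDelay D₂)
    (hB₁ : ∀ t, -S.delayMax ≤ t → ‖x₁ t‖ ≤ B) (hB₂ : ∀ t, -S.delayMax ≤ t → ‖x₂ t‖ ≤ B)
    (hV : LocallyLipschitzOn (Ici (0 : ℝ) ×ˢ (univ : Set (S.Hist × S.Hist)))
      fun p : ℝ × S.Hist × S.Hist => V p.1 p.2.1 p.2.2)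
    (hdecay : ∀ (φ₁ φ₂ : S.Hist) (v₁ v₂ : Fin m → ℝ) (d : Fin n → ℝ),
      (∀ s, ‖φ₁ s‖ ≤ B) → (∀ s, ‖φ₂ s‖ ≤ B) → ‖v₁‖ ≤ S.BU → ‖v₂‖ ≤ S.BU →
      ‖d‖ ≤ S.speedBound B * (S.delayMax - S.delayMin) →
      ρ ‖(v₁ - v₂, d)‖ ≤ Ma (φ₁ - φ₂) →
      ∀ᵐ t ∂(volume.restrict (Ici (0 : ℝ))),
        S.upperDeriv D₂ V t φ₁ φ₂ v₁ v₂ d ≤ ((-α₃ (Ma (φ₁ - φ₂)) : ℝ) : EReal))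
    {a b A : ℝ} (ha : 0 ≤ a) (hab : a ≤ b)
    (hdom : ∀ᵐ t, t ∈ Ioo a b →
      ρ ‖(u₁ (t - S.r) - u₂ (t - S.r), x₁ (t - D₁ t) - x₁ (t - D₂ t))‖ ≤
        Ma (History.curve x₁ h₁.continuousOn t - History.curve x₂ h₂.continuousOn t))
    (hA : ∀ t ∈ Ioo a b, A ≤
      α₃ (Ma (History.curve x₁ h₁.continuousOn t - History.curve x₂ h₂.continuousOn t))) :
    V b (History.curve x₁ h₁.continuousOn b) (History.curve x₂ h₂.continuousOn b) -
      V a (History.curve x₁ h₁.continuousOn a) (History.curve x₂ h₂.continuousOn a) ≤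
      -A * (b - a) := by
  set c₁ := History.curve x₁ h₁.continuousOn with hc₁
  set c₂ := History.curve x₂ h₂.continuousOn with hc₂
  have hL0 : 0 ≤ S.speedBound B := S.speedBound_nonneg B
  obtain ⟨L, hL⟩ : ∃ L : ℝ≥0, (L : ℝ) = S.speedBound B := ⟨⟨_, hL0⟩, rfl⟩
  have hx₁ := h₁.norm_sub_le_speedBound hξ₁ hu₁ hD₁ hB₁
  have hx₂ := h₂.norm_sub_le_speedBound hξ₂ hu₂ hD₂ hB₂
  rw [← hL] at hx₁ hx₂
  have hlip₁ : LipschitzWith L c₁ := History.lipschitzWith_curve h₁.continuousOn hx₁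
  have hlip₂ : LipschitzWith L c₂ := History.lipschitzWith_curve h₂.continuousOn hx₂
  let g : ℝ × ℝ → ℝ × S.Hist × S.Hist := fun p => (p.1, c₁ p.2, c₂ p.2)
  have hglip : LipschitzWith (max 1 (max (L * 1) (L * 1))) g :=
    LipschitzWith.prod_fst.prodMk
      ((hlip₁.comp LipschitzWith.prod_snd).prodMk (hlip₂.comp LipschitzWith.prod_snd))
  let Fn : ℝ × S.Hist × S.Hist → ℝ := fun p => V p.1 p.2.1 p.2.2
  let dom : Set (ℝ × S.Hist × S.Hist) := Ici (0 : ℝ) ×ˢ univ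
  let sq : Set (ℝ × ℝ) := Icc 0 (b + 1) ×ˢ Icc 0 (b + 1)
  have hQ : IsCompact (g '' sq) := (isCompact_Icc.prod isCompact_Icc).image hglip.continuous
  have hQdom : g '' sq ⊆ dom := by
    rintro _ ⟨p, hp, rfl⟩
    exact ⟨hp.1.1, mem_univ _⟩
  obtain ⟨δ, hδ, K, hK0, hK⟩ := hV.exists_uniform hQ hQdom
  obtain ⟨K', hK'⟩ := (hV.mono hQdom).exists_lipschitzOnWith_of_compact hQ
  obtain ⟨G, hG, hGF⟩ :=
    (hK'.comp hglip.lipschitzOnWith (mapsTo_image g sq)).extend_real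
  have hGV : ∀ p ∈ sq, G p = V p.1 (c₁ p.2) (c₂ p.2) := fun p hp => (hGF hp).symm
  have hbb : (b, b) ∈ sq := by
    have : b ∈ Icc 0 (b + 1) := ⟨ha.trans hab, by linarith⟩
    exact ⟨this, this⟩
  have haa : (a, a) ∈ sq := by
    have : a ∈ Icc 0 (b + 1) := ⟨ha, by linarith⟩
    exact ⟨this, this⟩
  -- A Lipschitz constant of the right-hand side, valid for all arguments that occur below.
  have hB0 : 0 ≤ B := (norm_nonneg _).trans (hB₁ 0 (neg_nonpos.2 S.delayMax_nonneg))
  obtain ⟨κ, hκ, hf⟩ := S.f_lipschitz (Metric.closedBall 0 (max (3 * B) S.BU))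
    Metric.isBounded_closedBall
  have hmem : ∀ (x y : Fin n → ℝ) (u : Fin m → ℝ), ‖x‖ ≤ B → ‖y‖ ≤ 3 * B → ‖u‖ ≤ S.BU →
      (x, y, u) ∈ Metric.closedBall (0 : (Fin n → ℝ) × (Fin n → ℝ) × (Fin m → ℝ))
        (max (3 * B) S.BU) := by
    intro x y u hx hy hu
    simp only [mem_closedBall_zero_iff, Prod.norm_def, sup_le_iff]
    exact ⟨le_max_of_le_left (by linarith), le_max_of_le_left hy, le_max_of_le_right hu⟩
  have hf' : ∀ (x y y' : Fin n → ℝ) (u : Fin m → ℝ), ‖x‖ ≤ B → ‖y‖ ≤ 3 * B → ‖y'‖ ≤ 3 * B →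
      ‖u‖ ≤ S.BU → ‖S.f x y u - S.f x y' u‖ ≤ κ * ‖y - y'‖ := by
    intro x y y' u hx hy hy' hu
    simpa using hf x y u x y' u (hmem x y u hx hy hu) (hmem x y' u hx hy' hu)
  rw [← hGV _ hbb, ← hGV _ haa]
  refine hG.diagonal_sub_le (E := K * (2 * (κ * (L * S.dMin)))) hab
    (by have := S.dMin_nonneg; positivity) ?_
  filter_upwards [hdom, (ae_restrict_iff' measurableSet_Ici).1 h₁.equation,
    (ae_restrict_iff' measurableSet_Ici).1 h₂.equation] with t hdom eq₁ eq₂ ht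
  have ht0 : 0 ≤ t := ha.trans ht.1.le
  have htm : -S.delayMax ≤ t := by linarith [S.delayMax_nonneg]
  have hur : -S.r ≤ t - S.r := by linarith
  set d := x₁ (t - D₁ t) - x₁ (t - D₂ t) with hd
  have hdle : ‖d‖ ≤ S.speedBound B * (S.delayMax - S.delayMin) := by
    refine (hx₁ _ _ (hD₁.sub_mem ht0) (hD₂.sub_mem ht0)).trans ?_
    rw [← hL]
    refine mul_le_mul_of_nonneg_left (abs_le.2 ⟨?_, ?_⟩) L.2 <;>
    linarith [(hD₁.mem t ht0).1, (hD₁.mem t ht0).2, (hD₂.mem t ht0).1, (hD₂.mem t ht0).2]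
  have hcB₁ : ∀ s, ‖c₁ t s‖ ≤ B := fun s => by
    rw [hc₁, History.curve_apply _ ht0]
    exact hB₁ _ (by linarith [s.2.1])
  have hcB₂ : ∀ s, ‖c₂ t s‖ ≤ B := fun s => by
    rw [hc₂, History.curve_apply _ ht0]
    exact hB₂ _ (by linarith [s.2.1])
  have hae := (ae_restrict_iff' measurableSet_Ici).1
    (hdecay (c₁ t) (c₂ t) (u₁ (t - S.r)) (u₂ (t - S.r)) d hcB₁ hcB₂
      (hu₁.bound _ hur) (hu₂.bound _ hur) hdle (hdom ht))
  filter_upwards [(measurePreserving_add_left volume t).quasiMeasurePreserving.ae hae]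
    with s hs hsI η hη
  have hts : 0 ≤ t + s := by linarith [hsI.1]
  specialize hs hts
  set v₁ := S.f (x₁ t) (x₁ (t - D₁ t)) (u₁ (t - S.r)) with hv₁
  set v₂ := S.f (x₂ t) (x₂ (t - D₂ t)) (u₂ (t - S.r)) with hv₂
  set w₁ := S.f (S.ev (c₁ t) 0) (S.ev (c₁ t) (-D₂ (t + s)) + d) (u₁ (t - S.r)) with hw₁
  set w₂ := S.f (S.ev (c₂ t) 0) (S.ev (c₂ t) (-D₂ (t + s))) (u₂ (t - S.r)) with hw₂
  have hzero : (0 : ℝ) ∈ Icc (-S.delayMax) 0 := ⟨neg_nonpos.2 S.delayMax_nonneg, le_rfl⟩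
  have hdel : |(t - D₂ t) - (t + -D₂ (t + s))| ≤ S.dMin * s := by
    have := hD₂.abs_sub_le hts ht0
    rw [add_sub_cancel_left, abs_of_pos hsI.1] at this
    refine le_of_eq_of_le ?_ this
    congr 1
    ring
  have hm' : -S.delayMax ≤ t + -D₂ (t + s) := by linarith [(hD₂.neg_mem hts).1]
  -- Evaluating the delay at `t + s` instead of `t` changes the slopes by `O(s)` only.
  have hvw₁ : ‖v₁ - w₁‖ ≤ κ * (L * (S.dMin * s)) := by
    rw [hv₁, hw₁, hc₁, ev, ev, History.eval_curve _ _ ht0 hzero, add_zero,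
      History.eval_curve _ _ ht0 (hD₂.neg_mem hts)]
    have e1 := hB₁ _ hm'
    have e2 := hB₁ _ (hD₁.sub_mem ht0)
    have e3 := hB₁ _ (hD₂.sub_mem ht0)
    refine (hf' _ _ _ _ (hB₁ t htm) (by linarith) ?_ (hu₁.bound _ hur)).trans ?_
    · rw [hd]
      linarith [norm_add_le (x₁ (t + -D₂ (t + s))) (x₁ (t - D₁ t) - x₁ (t - D₂ t)),
        _root_.norm_sub_le (x₁ (t - D₁ t)) (x₁ (t - D₂ t))]
    · refine mul_le_mul_of_nonneg_left ?_ hκ.le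
      have : x₁ (t - D₁ t) - (x₁ (t + -D₂ (t + s)) + d) =
          x₁ (t - D₂ t) - x₁ (t + -D₂ (t + s)) := by
        rw [hd]
        abel
      rw [this]
      exact (hx₁ _ _ (hD₂.sub_mem ht0) hm').trans (mul_le_mul_of_nonneg_left hdel L.2)
  have hvw₂ : ‖v₂ - w₂‖ ≤ κ * (L * (S.dMin * s)) := by
    rw [hv₂, hw₂, hc₂, ev, ev, History.eval_curve _ _ ht0 hzero, add_zero,
      History.eval_curve _ _ ht0 (hD₂.neg_mem hts)]
    have e1 := hB₂ _ hm'
    have e3 := hB₂ _ (hD₂.sub_mem ht0)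
    refine (hf' _ _ _ _ (hB₂ t htm) (by linarith) (by linarith) (hu₂.bound _ hur)).trans ?_
    refine mul_le_mul_of_nonneg_left ?_ hκ.le
    exact (hx₂ _ _ (hD₂.sub_mem ht0) hm').trans (mul_le_mul_of_nonneg_left hdel L.2)
  set e := κ * (L * (S.dMin * s)) with he
  have he0 : 0 ≤ e := (norm_nonneg _).trans hvw₁
  set η' := η / (2 * (K + 1)) with hη'
  have hη'0 : 0 < η' := by positivity
  have hKη : K * η' ≤ η / 2 := by
    rw [hη', show K * (η / (2 * (K + 1))) = η / 2 * (K / (K + 1)) by field_simp]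
    exact mul_le_of_le_one_right (by linarith) ((div_le_one (by linarith)).2 (by linarith))
  have hq : ∀ᶠ θ in 𝓝[>] (0 : ℝ),
      (V (t + s + θ) ((c₁ t).advance S.delayMax_nonneg w₁ θ)
        ((c₂ t).advance S.delayMax_nonneg w₂ θ) - V (t + s) (c₁ t) (c₂ t)) / θ <
      -α₃ (Ma (c₁ t - c₂ t)) + η / 2 := by
    have hlt : S.upperDeriv D₂ V (t + s) (c₁ t) (c₂ t) (u₁ (t - S.r)) (u₂ (t - S.r)) d <
        ((-α₃ (Ma (c₁ t - c₂ t)) + η / 2 : ℝ) : EReal) :=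
      hs.trans_lt (EReal.coe_lt_coe_iff.2 (by linarith))
    filter_upwards [eventually_lt_of_limsup_lt hlt] with θ hθ
    exact EReal.coe_lt_coe_iff.1 hθ
  have hclose : ∀ᶠ θ in 𝓝[>] (0 : ℝ), dist (g (t + s + θ, t + θ)) (g (t + s, t)) < δ / 2 := by
    have hc : Continuous fun θ : ℝ => g (t + s + θ, t + θ) :=
      hglip.continuous.comp (by fun_prop)
    have := (hc.tendsto 0).mono_left (nhdsWithin_le_nhds (s := Ioi (0 : ℝ)))
    simp only [add_zero] at this
    exact Metric.tendsto_nhds.1 this (δ / 2) (half_pos hδ)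
  have hsmall : ∀ᶠ θ in 𝓝[>] (0 : ℝ), θ * (η' + e) < δ / 2 := by
    have hc : Continuous fun θ : ℝ => θ * (η' + e) := by fun_prop
    have := (hc.tendsto 0).mono_left (nhdsWithin_le_nhds (s := Ioi (0 : ℝ)))
    simp only [zero_mul] at this
    exact this.eventually_lt_const (half_pos hδ)
  have hθ1 : ∀ᶠ θ in 𝓝[>] (0 : ℝ), θ < b - t ∧ θ < 1 - s := by
    have h1 : 0 < min (b - t) (1 - s) := lt_min (by linarith [ht.2]) (by linarith [hsI.2])
    filter_upwards [Ioo_mem_nhdsGT h1] with θ hθ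
    exact lt_min_iff.1 hθ.2
  filter_upwards [hq, hclose, hsmall, hθ1, self_mem_nhdsWithin,
    History.eventually_norm_curve_sub_advance_le h₁.continuousOn S.delayMax_nonneg ht0
      (eq₁ ht0) hη'0,
    History.eventually_norm_curve_sub_advance_le h₂.continuousOn S.delayMax_nonneg ht0
      (eq₂ ht0) hη'0] with θ hq hclose hsmall hθb hθ0 hadv₁ hadv₂
  replace hθ0 : 0 < θ := hθ0
  have hst : (t + s, t) ∈ sq :=
    ⟨⟨hts, by linarith [hsI.2, ht.2]⟩, ht0, by linarith [ht.2]⟩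
  have hstθ : (t + s + θ, t + θ) ∈ sq :=
    ⟨⟨by linarith, by linarith⟩, by linarith, by linarith⟩
  rw [hGV _ hst, hGV _ hstθ]
  set p' : ℝ × S.Hist × S.Hist := (t + s + θ, (c₁ t).advance S.delayMax_nonneg w₁ θ,
    (c₂ t).advance S.delayMax_nonneg w₂ θ) with hp'
  have hdist : dist (g (t + s + θ, t + θ)) p' ≤ θ * (η' + e) := by
    have i1 : ‖c₁ (t + θ) - (c₁ t).advance S.delayMax_nonneg w₁ θ‖ ≤ θ * (η' + e) :=
      (hadv₁ w₁).trans (by gcongr)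
    have i2 : ‖c₂ (t + θ) - (c₂ t).advance S.delayMax_nonneg w₂ θ‖ ≤ θ * (η' + e) :=
      (hadv₂ w₂).trans (by gcongr)
    rw [← dist_eq_norm] at i1 i2
    simp only [g, hp', Prod.dist_eq, dist_self]
    exact max_le (by positivity) (max_le i1 i2)
  have hVV := hK (g (t + s, t)) (mem_image_of_mem g hst) (g (t + s + θ, t + θ))
    (hQdom (mem_image_of_mem g hstθ)) p' ⟨by
      simp only [hp', mem_Ici]
      linarith, mem_univ _⟩ (by linarith)
    (by linarith [dist_triangle_left p' (g (t + s, t)) (g (t + s + θ, t + θ))])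
  have hVV' := (le_abs_self _).trans (hVV.trans (mul_le_mul_of_nonneg_left hdist hK0))
  have hq' := (div_lt_iff₀ hθ0).1 hq
  have hAt := mul_le_mul_of_nonneg_left (hA t ht) hθ0.le
  have hηθ := mul_le_mul_of_nonneg_left hKη hθ0.le
  have hKe : 0 ≤ θ * (K * e) := by positivity
  simp only [g, hp'] at hVV'
  calc _ ≤ K * (θ * (η' + e)) + (-α₃ (Ma (c₁ t - c₂ t)) + η / 2) * θ := by linarith
    _ ≤ θ * (-A + 2 * (K * e) + η) := by linarith
    _ = _ := by
      rw [he]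
      ring

end TimeDelaySystem

/-! ### From the decay of the functional to the stability estimate -/

theorem mainTheorem3 {n m : ℕ} (S : TimeDelaySystem n m)
    (βISS : ℝ → ℝ → ℝ) (γISS : ℝ → ℝ) (hISS : S.ISSWith βISS γISS)
    (hV : ∃ V : (ℝ → ℝ) → ℝ → S.Hist → S.Hist → ℝ, S.IsLKF (S.BX βISS γISS) V) :
    S.IsDeltaIDSS := by
  obtain ⟨V, hVlip, α₁, α₂, α₃, ρ, γlow, γup, Ma, hα₁, hα₂, hα₃, hρ, hγlow, hγup, -, hMa, hVD⟩ := hV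
  obtain ⟨κ₁, hκ₁, hκ₁l, hκ₁r⟩ := hα₁.exists_inverse
  obtain ⟨κ₂, hκ₂, hκ₂l, hκ₂r⟩ := hα₂.exists_inverse
  have hα : ClassK fun y => α₃ (κ₂ y) := hα₃.comp hκ₂
  obtain ⟨b, hb, hbw⟩ := hα.exists_classKL
  set L := S.speedBound (S.BX βISS γISS) with hL
  have hL0 : 0 ≤ L := S.speedBound_nonneg _
  -- `γ c` bounds the state difference as long as `α₂ (ρ c)` bounds the functional.
  let γ : ℝ → ℝ := fun c => κ₁ (α₂ (ρ c))
  have hγ : ClassK γ := hκ₁.comp (hα₂.toClassK.comp hρ)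
  let β₀ : ℝ → ℝ → ℝ := fun w t => κ₁ (b (α₂ (γup w)) t) + Real.exp (-t) * w
  have hβ₀ : ClassKL β₀ :=
    (hb.comp hκ₁ (hα₂.toClassK.comp hγup.toClassK)).add ClassKL.mul_exp_neg
  -- The slope `L + 1` instead of `L` keeps the gain in class `K` if `L = 0`.
  refine ⟨fun w t => β₀ w (max (t - S.delayMax) 0), γ, fun c => γ ((L + 1) * c),
    hβ₀.delay _, hγ, hγ.comp (ClassK.const_mul_id (by linarith)), ?_⟩
  intro ξ₁ ξ₂ u₁ u₂ D₁ D₂ hξ₁ hξ₂ hu₁ hu₂ hD₁ hD₂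
  refine ⟨hISS.existence ξ₁ u₁ D₁ hu₁ hD₁, hISS.existence ξ₂ u₂ D₂ hu₂ hD₂, ?_⟩
  intro x₁ x₂ h₁ h₂ t ht
  have hB₁ : ∀ s, -S.delayMax ≤ s → ‖x₁ s‖ ≤ S.BX βISS γISS := fun s =>
    h₁.norm_le hISS hξ₁.bound hu₁ hD₁
  have hB₂ : ∀ s, -S.delayMax ≤ s → ‖x₂ s‖ ≤ S.BX βISS γISS := fun s =>
    h₂.norm_le hISS hξ₂.bound hu₂ hD₂
  obtain ⟨hVb, hVdec⟩ := hVD D₂ hD₂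
  set ū := essNorm (fun s => u₁ s - u₂ s) (Ico (-S.r) (t - S.r)) with hū
  set δ := essNorm (fun s => D₁ s - D₂ s) (Ico 0 t) with hδ
  have hū0 : 0 ≤ ū := TimeDelaySystem.essNorm_nonneg _ _
  have hδ0 : 0 ≤ δ := TimeDelaySystem.essNorm_nonneg _ _
  set c := max ū ((L + 1) * δ) with hc
  have hc0 : 0 ≤ c := hū0.trans (le_max_left _ _)
  set w := ‖ξ₁ - ξ₂‖ with hw
  have hw0 : 0 ≤ w := norm_nonneg _
  have hr0 : 0 ≤ max (t - S.delayMax) 0 := le_max_right _ _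
  -- Along the solutions the disturbances are bounded by `c`.
  have hu_ae : ∀ᵐ s, s ∈ Ico 0 t → ‖u₁ (s - S.r) - u₂ (s - S.r)‖ ≤ ū := by
    have h := TimeDelaySystem.ae_norm_le_essNorm (g := fun s => u₁ s - u₂ s) (c := S.BU + S.BU)
      (I := Ico (-S.r) (t - S.r)) measurableSet_Ico fun s hs =>
      (norm_sub_le _ _).trans (add_le_add (hu₁.bound s hs.1) (hu₂.bound s hs.1))
    filter_upwards [(measurePreserving_sub_right volume S.r).quasiMeasurePreserving.ae h]
      with s hs hsI
    exact hs ⟨by linarith [hsI.1], by linarith [hsI.2]⟩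
  have hD_ae : ∀ᵐ s, s ∈ Ico 0 t → |D₁ s - D₂ s| ≤ δ := by
    refine TimeDelaySystem.ae_norm_le_essNorm (g := fun s => D₁ s - D₂ s)
      (c := S.delayMax - S.delayMin) (I := Ico 0 t) measurableSet_Ico fun s hs => ?_
    refine abs_le.2 ⟨?_, ?_⟩ <;>
    linarith [(hD₁.mem s hs.1).1, (hD₁.mem s hs.1).2, (hD₂.mem s hs.1).1, (hD₂.mem s hs.1).2]
  have hdist : ∀ᵐ s, s ∈ Ico 0 t →
      ‖(u₁ (s - S.r) - u₂ (s - S.r), x₁ (s - D₁ s) - x₁ (s - D₂ s))‖ ≤ c := by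
    filter_upwards [hu_ae, hD_ae] with s h h' hs
    refine max_le ((h hs).trans (le_max_left _ _)) (le_trans ?_ (le_max_right _ _))
    refine (h₁.norm_sub_le_speedBound hξ₁ hu₁ hD₁ hB₁ _ _ (hD₁.sub_mem hs.1)
      (hD₂.sub_mem hs.1)).trans ?_
    rw [sub_sub_sub_cancel_left, abs_sub_comm]
    exact mul_le_mul (by linarith) (h' hs) (abs_nonneg _) (by linarith)
  set c₁ := History.curve x₁ h₁.continuousOn with hc₁
  set c₂ := History.curve x₂ h₂.continuousOn with hc₂
  let W : ℝ → ℝ := fun s => V D₂ s (c₁ s) (c₂ s)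
  have hMa0 : ∀ φ, 0 ≤ Ma φ := fun φ => (hγlow.nonneg (norm_nonneg _)).trans (hMa φ).1
  have hc₁cont : Continuous c₁ := (History.lipschitzWith_curve (L := ⟨L, hL0⟩) h₁.continuousOn
    (h₁.norm_sub_le_speedBound hξ₁ hu₁ hD₁ hB₁)).continuous
  have hc₂cont : Continuous c₂ := (History.lipschitzWith_curve (L := ⟨L, hL0⟩) h₂.continuousOn
    (h₂.norm_sub_le_speedBound hξ₂ hu₂ hD₂ hB₂)).continuous
  have hWcont : ContinuousOn W (Ici 0) :=
    (hVlip D₂ hD₂).continuousOn.comp (f := fun s => (s, c₁ s, c₂ s)) (by fun_prop)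
      fun s hs => ⟨hs, mem_univ _⟩
  -- The current state difference is bounded with the help of the comparison principle.
  have hpoint : ∀ s, 0 ≤ s → s ≤ t → ‖x₁ s - x₂ s‖ ≤ max (β₀ w s) (γ c) := by
    intro s hs hst
    have hzero : (0 : ℝ) ∈ Icc (-S.delayMax) 0 := ⟨neg_nonpos.2 S.delayMax_nonneg, le_rfl⟩
    have hxW : ‖x₁ s - x₂ s‖ ≤ κ₁ (W s) := by
      have h := (hVb s hs (c₁ s) (c₂ s)).1
      rw [hc₁, hc₂, TimeDelaySystem.ev, TimeDelaySystem.ev, History.eval_curve _ _ hs hzero,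
        History.eval_curve _ _ hs hzero, add_zero] at h
      rw [← hκ₁l _ (norm_nonneg _)]
      exact hκ₁.mono (hα₁.nonneg (norm_nonneg _)) h
    have hW0 : ∀ τ, 0 ≤ τ → 0 ≤ W τ := fun τ hτ =>
      (hα₁.nonneg (norm_nonneg _)).trans (hVb τ hτ _ _).1
    have hk0 : 0 ≤ α₂ (ρ c) := hα₂.nonneg (hρ.nonneg hc0)
    rcases le_or_gt (W s) (α₂ (ρ c)) with hle | hgt
    · exact hxW.trans ((hκ₁.mono (hW0 s hs) hle).trans (le_max_right _ _))
    refine le_max_of_le_left (hxW.trans ?_)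
    have hdecay := add_mul_le_of_decay hα hs hk0 (hWcont.mono Icc_subset_Ici_self)
      (fun y hy a ha has hyW => by
        have hy0 : 0 ≤ y := hk0.trans hy.le
        have hyMa : ∀ τ ∈ Ioo a s, κ₂ y ≤ Ma (c₁ τ - c₂ τ) := fun τ hτ => by
          rw [← hκ₂l (Ma (c₁ τ - c₂ τ)) (hMa0 _)]
          exact hκ₂.mono hy0 ((hyW τ ⟨hτ.1.le, hτ.2.le⟩).trans
            (hVb τ (ha.trans hτ.1.le) _ _).2)
        refine h₁.functional_sub_le h₂ hξ₁ hξ₂ hu₁ hu₂ hD₁ hD₂ hB₁ hB₂ (hVlip D₂ hD₂) hVdec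
          ha has ?_ fun τ hτ => hα₃.mono (hκ₂.nonneg hy0) (hyMa τ hτ)
        filter_upwards [hdist] with τ h hτ
        calc _ ≤ ρ c := hρ.mono (norm_nonneg _) (h ⟨ha.trans hτ.1.le, hτ.2.trans_le hst⟩)
          _ = κ₂ (α₂ (ρ c)) := (hκ₂l _ (hρ.nonneg hc0)).symm
          _ ≤ κ₂ y := hκ₂.mono hk0 hy.le
          _ ≤ _ := hyMa τ hτ) hgt
    have hinit : c₁ 0 - c₂ 0 = ξ₁ - ξ₂ := by
      ext1 θ
      rw [ContinuousMap.sub_apply, ContinuousMap.sub_apply, hc₁, hc₂,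
        History.curve_apply _ le_rfl, History.curve_apply _ le_rfl, zero_add, h₁.initial,
        h₂.initial]
    have hWw : W 0 ≤ α₂ (γup w) := by
      refine (hVb 0 le_rfl _ _).2.trans (hα₂.mono (hMa0 _) ?_)
      rw [hinit]
      exact (hMa _).2
    have hWb : W s ≤ b (α₂ (γup w)) s :=
      hbw _ _ _ (hα₂.nonneg (hγup.nonneg hw0)) hs (hW0 s hs) (hdecay.trans hWw)
    have hexp : 0 ≤ Real.exp (-s) * w := by positivity
    have := hκ₁.mono (hW0 s hs) hWb
    simp only [β₀]
    linarith
  have hγc : γ c ≤ γ ū + γ ((L + 1) * δ) := by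
    rcases max_choice ū ((L + 1) * δ) with h | h <;> rw [hc, h]
    · linarith [hγ.nonneg (x := (L + 1) * δ) (by positivity)]
    · linarith [hγ.nonneg hū0]
  have hpos : 0 ≤ β₀ w (max (t - S.delayMax) 0) := hβ₀.nonneg hw0 hr0
  refine (ContinuousMap.norm_le _ (hpos.trans (le_max_left _ _))).2 fun θ => ?_
  have hval : (History.segment x₁ h₁.continuousOn t ht - History.segment x₂ h₂.continuousOn t ht)
      θ = x₁ (t + θ) - x₂ (t + θ) := rfl
  rw [hval]
  rcases le_total 0 (t + (θ : ℝ)) with h0 | h0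
  · refine (hpoint _ h0 (by linarith [θ.2.2])).trans (max_le_max ?_ hγc)
    exact hβ₀.antitoneOn w hw0 hr0 h0 (max_le (by linarith [θ.2.1]) h0)
  · -- The segment still contains a part of the initial histories.
    have hmem : t + (θ : ℝ) ∈ Icc (-S.delayMax) 0 := ⟨by linarith [θ.2.1], h0⟩
    have hmax : max (t - S.delayMax) 0 = 0 := max_eq_right (by linarith [θ.2.1])
    rw [h₁.initial ⟨_, hmem⟩, h₂.initial ⟨_, hmem⟩, hmax]
    refine le_trans ((ξ₁ - ξ₂).norm_coe_le_norm ⟨_, hmem⟩) (le_trans ?_ (le_max_left _ _))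
    have := hκ₁.nonneg (hb.nonneg (w := α₂ (γup w)) (t := 0)
      (hα₂.nonneg (hγup.nonneg hw0)) le_rfl)
    simp only [β₀, neg_zero, Real.exp_zero, one_mul]
    linarith
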